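/- Let $\Lambda$ be the lambda algebra: the associative unital $\mathbb F_2$-algebra generated by $\lambda_t$, $t\ge 0$, with the relations $\lambda_k\lambda_\ell=\sum_{t\ge 0}\binom{t-\ell-1}{2t-k}\lambda_{k+\ell-t}\lambda_t$ for $k>2\ell$, and let $\Lambda_k$ be the span of the monomials $\lambda_J=\lambda_{j_1}\cdots\lambda_{j_k}$ of length $k$. Throughout, binomial coefficients are taken mod 2, $\binom nm=0$ unless $0\le m\le n$, and $\lambda_n=0$ for $n<0$. Let $H_*(B(\mathbb Z/2)^k;\mathbb F_2)=\Gamma[a_k,\dots,a_1]$, with basis $a^{(I)}=a_k^{(i_k)}\cdots a_1^{(i_1)}$ dual to the monomials $x^I=x_1^{i_1}\cdots x_k^{i_k}$ of $H^*=\mathbb F_2[x_1,\dots,x_k]$, and let $z\mapsto (z)Sq_*^j$ be the transpose of the Steenrod square $Sq^j$. For $1\le m\le k$ put $V_m=\prod_{c_1,\dots,c_{m-1}\in\mathbb F_2}(x_m+c_{m-1}x_{m-1}+\cdots+c_1x_1)$ and $v_m=V_m/(V_1\cdots V_{m-1})$, rational functions expanded in the field of iterated Laurent series $\mathbb F_2((x_k))\cdots((x_2))((x_1))$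 (so that $\frac1{x_1+x_2}=\sum_{n\ge0}x_1^nx_2^{-n-1}$). The Chon–Hà representation of the Singer transfer is the linear map $$\varphi_k:H_*(B(\mathbb Z/2)^k)\to\Lambda_k,\qquad \varphi_k(a^{(I)})=\sum_{J\in\mathbb N^k}\langle a^{(I)},v^J\rangle\lambda_J,$$ where $\langle a^{(I)},v^J\rangle$ is the coefficient of $x^I$ in the expansion of $v^J=v_1^{j_1}\cdots v_k^{j_k}$. Then the following hold. (1) For all $k\ge1$ and $t_1,\dots,t_k\ge0$, where $a_k^{(t_k)}\cdots a_2^{(t_2)}$ is regarded as the element $a_{k-1}^{(t_k)}\cdots a_1^{(t_2)}$ of $H_*(B(\mathbb Z/2)^{k-1})$, $$\varphi_k\big(a_k^{(t_k)}\cdots a_1^{(t_1)}\big)=\sum_{i\ge t_1}\lambda_i\cdot\varphi_{k-1}\big((a_k^{(t_k)}\cdots a_2^{(t_2)})Sq_*^{i-t_1}\big),$$ and only finitely many of the elements $(a_k^{(t_k)}\cdots a_2^{(t_2)})Sq_*^{i-t_1}$ are non-zero. In (2)–(4) all the indices $i_j,u_j,k_j,w_j$ are non-negative integers, the $t_j$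 are arbitrary non-negative integers, and $T$ denotes the sum of the $t_j$. (2) $\varphi_3(a_3^{(t_3)}a_2^{(t_2)}a_1^{(t_1)})$ equals $$\sum_{i_1\ge t_1}\ \sum_{u_1+u_2=i_1-t_1}\ \sum_{i_2\ge t_2-u_2}\binom{t_3-u_1}{u_1}\binom{t_2-u_2}{u_2}\binom{T-i_1-i_2}{i_2+u_2-t_2}\lambda_{i_1}\lambda_{i_2}\lambda_{T-i_1-i_2}.$$ (3) $\varphi_4(a_4^{(t_4)}a_3^{(t_3)}a_2^{(t_2)}a_1^{(t_1)})$ equals $$\sum_{i_1\ge t_1}\ \sum_{k_1+k_2+k_3=i_1-t_1}\ \sum_{i_2\ge t_2-k_3}\ \sum_{u_1+u_2=i_2+k_3-t_2}\ \sum_{i_3\ge t_3-k_2-u_2}\binom{t_4-k_1}{k_1}\binom{t_3-k_2}{k_2}\binom{t_2-k_3}{k_3}\binom{t_4-k_1-u_1}{u_1}\binom{t_3-k_2-u_2}{u_2}$$ $$\cdot\binom{T-i_1-i_2-i_3}{i_3+k_2+u_2-t_3}\lambda_{i_1}\lambda_{i_2}\lambda_{i_3}\lambda_{T-i_1-i_2-i_3}.$$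 (4) $\varphi_5(a_5^{(t_5)}a_4^{(t_4)}a_3^{(t_3)}a_2^{(t_2)}a_1^{(t_1)})$ equals $$\sum_{i_1\ge t_1}\ \sum_{w_1+w_2+w_3+w_4=i_1-t_1}\ \sum_{i_2\ge t_2-w_4}\ \sum_{k_1+k_2+k_3=i_2+w_4-t_2}\ \sum_{i_3\ge t_3-k_3-w_3}\ \sum_{u_1+u_2=i_3+k_3+w_3-t_3}\ \sum_{i_4\ge t_4-k_2-u_2-w_2}$$ $$\binom{t_5-w_1}{w_1}\binom{t_4-w_2}{w_2}\binom{t_3-w_3}{w_3}\binom{t_2-w_4}{w_4}\binom{t_5-k_1-w_1}{k_1}\binom{t_4-k_2-w_2}{k_2}\binom{t_3-k_3-w_3}{k_3}\binom{t_5-k_1-u_1-w_1}{u_1}\binom{t_4-k_2-u_2-w_2}{u_2}$$ $$\cdot\binom{T-i_1-i_2-i_3-i_4}{i_4+k_2+u_2+w_2-t_4}\lambda_{i_1}\lambda_{i_2}\lambda_{i_3}\lambda_{i_4}\lambda_{T-i_1-i_2-i_3-i_4}.$$ -/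

import Mathlib

noncomputable section

namespace SingerTransfer

/-! ### The lambda algebra -/

/-- The binomial coefficient `binom n m` modulo 2 for integers `n`, `m`, with the convention that it
vanishes unless `0 ≤ m ≤ n`. -/
def binom (n m : ℤ) : ZMod 2 :=
  if 0 ≤ m ∧ m ≤ n then (Nat.choose n.toNat m.toNat : ZMod 2) else 0

/-- The Adem relations
`λ_k λ_l = ∑_{t ≥ 0} binom (t - l - 1) (2 t - k) λ_{k + l - t} λ_t` for `2 l < k`.
The binomial coefficient vanishes for `t > k + l`. -/
inductive AdemRel : FreeAlgebra (ZMod 2) ℕ → FreeAlgebra (ZMod 2) ℕ → Prop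
  | rel (k l : ℕ) (h : 2 * l < k) :
      AdemRel (FreeAlgebra.ι (ZMod 2) k * FreeAlgebra.ι (ZMod 2) l)
        (∑ t ∈ Finset.range (k + l + 1), binom ((t : ℤ) - l - 1) (2 * t - k) •
          (FreeAlgebra.ι (ZMod 2) (k + l - t) * FreeAlgebra.ι (ZMod 2) t))

/-- The lambda algebra, as an algebra over `ℤ/2`. -/
abbrev Lambda : Type := RingQuot AdemRel

/-- The generator `λ_t`. -/
def lam (t : ℕ) : Lambda := RingQuot.mkAlgHom (ZMod 2) AdemRel (FreeAlgebra.ι (ZMod 2) t)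

/-- `λ_n` for an integer `n`, equal to `0` for `n < 0`. -/
def lamZ (n : ℤ) : Lambda := if 0 ≤ n then lam n.toNat else 0

/-- The monomial `λ_J = λ_{j_1} λ_{j_2} ⋯ λ_{j_k}`. The coordinate with index `i : Fin k` is the one
with number `i + 1` in the usual notation. -/
def lamMon {k : ℕ} (J : Fin k → ℕ) : Lambda := (List.ofFn fun i => lam (J i)).prod

/-- The subspace `Λ_k` spanned by the monomials of length `k`. -/
def LambdaLen (k : ℕ) : Submodule (ZMod 2) Lambda :=
  Submodule.span (ZMod 2) (Set.range fun J : Fin k → ℕ => lamMon J)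

/-! ### Homology of `B(ℤ/2)^k` and dual Steenrod operations -/

/-- The cohomology `H^*(B(ℤ/2)^k) = ℤ/2[x_1, …, x_k]`. -/
abbrev Cohomology (k : ℕ) : Type := MvPolynomial (Fin k) (ZMod 2)

/-- The total Steenrod square `f ↦ ∑_j Sq^j(f) T^j`: the ring homomorphism (Cartan formula) with
`x_i ↦ x_i + x_i ^ 2 T`. -/
def totalSq (k : ℕ) : Cohomology k →ₐ[ZMod 2] Polynomial (Cohomology k) :=
  MvPolynomial.aeval fun i =>
    Polynomial.C (MvPolynomial.X i) + Polynomial.C (MvPolynomial.X i ^ 2) * Polynomial.X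

/-- The Steenrod square `Sq^j` on `H^*(B(ℤ/2)^k)`. -/
def Sq {k : ℕ} (j : ℕ) : Cohomology k →ₗ[ZMod 2] Cohomology k :=
  ((Polynomial.lcoeff (Cohomology k) j).restrictScalars (ZMod 2)) ∘ₗ (totalSq k).toLinearMap

/-- The homology `H_*(B(ℤ/2)^k) = Γ[a_k, …, a_1]`: the graded dual of `H^*(B(ℤ/2)^k)`, given as the
vector space on the basis `a^{(I)} = a_k^{(i_k)} ⋯ a_1^{(i_1)}` dual to the monomials `x^I`. -/
abbrev Homology (k : ℕ) : Type := (Fin k →₀ ℕ) →₀ ZMod 2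

/-- The basis element `a_k^{(t_k)} ⋯ a_1^{(t_1)}`; here `t i` is the exponent of `a_{i+1}`. -/
def aMon {k : ℕ} (t : Fin k → ℕ) : Homology k := Finsupp.single (Finsupp.equivFunOnFinite.symm t) 1

/-- The duality pairing between homology and cohomology. -/
def pairing {k : ℕ} : Homology k →ₗ[ZMod 2] Cohomology k →ₗ[ZMod 2] ZMod 2 :=
  Finsupp.linearCombination (ZMod 2) fun I => MvPolynomial.lcoeff (ZMod 2) I

/-- The dual Steenrod operation `z ↦ (z) Sq_*^j`, the transpose of `Sq^j`
(see `pairing_SqStar`). The monomial `x^I` can occur in `Sq^j(x^K)` only if `K ≤ I`. -/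
def SqStar {k : ℕ} (j : ℕ) : Homology k →ₗ[ZMod 2] Homology k :=
  Finsupp.linearCombination (ZMod 2) fun I =>
    ∑ K ∈ Finset.Iic I,
      Finsupp.single K (MvPolynomial.coeff I (Sq j (MvPolynomial.monomial K (1 : ZMod 2))))

theorem coeff_Sq_monomial {k : ℕ} (j : ℕ) (I K : Fin k →₀ ℕ) (h : ¬ K ≤ I) :
    MvPolynomial.coeff I (Sq j (MvPolynomial.monomial K (1 : ZMod 2))) = 0 := by
  have hdvd : Polynomial.C (MvPolynomial.monomial K (1 : ZMod 2)) ∣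
      totalSq k (MvPolynomial.monomial K (1 : ZMod 2)) := by
    have hK : MvPolynomial.monomial K (1 : ZMod 2) = ∏ i, MvPolynomial.X i ^ K i := by
      rw [MvPolynomial.monomial_eq, map_one, one_mul,
        Finsupp.prod_fintype _ _ (fun i => pow_zero _)]
    rw [hK, map_prod, map_prod]
    refine Finset.prod_dvd_prod_of_dvd _ _ fun i _ => ?_
    rw [map_pow, map_pow]
    refine pow_dvd_pow_of_dvd ?_ _
    refine ⟨1 + Polynomial.C (MvPolynomial.X i) * Polynomial.X, ?_⟩
    simp only [totalSq, MvPolynomial.aeval_X, map_pow]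
    ring
  obtain ⟨q, hq⟩ := hdvd
  have : Sq j (MvPolynomial.monomial K (1 : ZMod 2)) =
      MvPolynomial.monomial K (1 : ZMod 2) * q.coeff j := by
    change (totalSq k (MvPolynomial.monomial K (1 : ZMod 2))).coeff j = _
    rw [hq, Polynomial.coeff_C_mul]
  rw [this, MvPolynomial.coeff_monomial_mul', if_neg h]

/-- `SqStar j` is the transpose of `Sq j`: `⟨(z) Sq_*^j, f⟩ = ⟨z, Sq^j f⟩`. -/
theorem pairing_SqStar {k : ℕ} (j : ℕ) (z : Homology k) (f : Cohomology k) :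
    pairing (SqStar j z) f = pairing z (Sq j f) := by
  suffices h : pairing ∘ₗ SqStar (k := k) j = (pairing (k := k)).compl₂ (Sq j) from
    LinearMap.congr_fun (LinearMap.congr_fun h z) f
  refine Finsupp.lhom_ext' fun I => LinearMap.ext_ring ?_
  refine MvPolynomial.linearMap_ext fun M => LinearMap.ext_ring ?_
  have hp : ∀ (K : Fin k →₀ ℕ) (c : ZMod 2) (g : Cohomology k),
      pairing (Finsupp.single K c) g = c * MvPolynomial.coeff K g := by
    intro K c g
    simp [pairing, Finsupp.linearCombination_single, MvPolynomial.lcoeff]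
  simp only [LinearMap.comp_apply, Finsupp.lsingle_apply, LinearMap.compl₂_apply, SqStar,
    Finsupp.linearCombination_single, one_smul, map_sum, LinearMap.sum_apply, hp, one_mul,
    MvPolynomial.coeff_monomial]
  by_cases hM : M ≤ I
  · rw [Finset.sum_eq_single M]
    · simp
    · intro K _ hK
      simp [Ne.symm hK]
    · intro hM'
      exact absurd (Finset.mem_Iic.2 hM) hM'
  · rw [coeff_Sq_monomial j I M hM, Finset.sum_eq_zero]
    intro K hK
    have : M ≠ K := fun h => hM (h ▸ Finset.mem_Iic.1 hK)
    simp [this]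

/-! ### The transfer -/

/-- The field of iterated Laurent series `ℤ/2((x_k)) ⋯ ((x_2))((x_1))`, as Hahn series: exponents are
compared lexicographically, the exponent of `x_1` first. Rational functions in `x_1, …, x_k` are
expanded in it, for instance `1 / (x_1 + x_2) = ∑_{n ≥ 0} x_1 ^ n x_2 ^ (- n - 1)`. -/
abbrev Laurent (k : ℕ) : Type := HahnSeries (Lex (Fin k → ℤ)) (ZMod 2)

/-- The variable `x_{i+1}`. -/
def xvar {k : ℕ} (i : Fin k) : Laurent k := HahnSeries.single (toLex (Pi.single i 1)) 1

/-- The invariant `V_m = ∏ (x_m + c_{m-1} x_{m-1} + ⋯ + c_1 x_1)`, over all `c_j` in `ℤ/2`. -/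
def bigV {k : ℕ} (m : Fin k) : Laurent k :=
  ∏ S ∈ (Finset.Iio m).powerset, (xvar m + ∑ j ∈ S, xvar j)

/-- The invariant `v_m = V_m / (V_1 ⋯ V_{m-1})`, of degree 1. -/
def smallv {k : ℕ} (m : Fin k) : Laurent k := bigV m / ∏ j ∈ Finset.Iio m, bigV j

/-- The coefficient `⟨a^{(I)}, v^J⟩` of `x^I` in the expansion of `v^J = v_1^{j_1} ⋯ v_k^{j_k}`. -/
def vCoeff {k : ℕ} (I : Fin k →₀ ℕ) (J : Fin k → ℕ) : ZMod 2 :=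
  (∏ m, (smallv m : Laurent k) ^ J m).coeff (toLex fun i => (I i : ℤ))

/-- The transfer `φ_k : H_*(B(ℤ/2)^k) → Λ_k`, `a^{(I)} ↦ ∑_J ⟨a^{(I)}, v^J⟩ λ_J`. As `v^J` is
homogeneous of degree `j_1 + ⋯ + j_k`, only those `J` contribute whose sum is that of `I`. -/
def phi (k : ℕ) : Homology k →ₗ[ZMod 2] LambdaLen k :=
  Finsupp.linearCombination (ZMod 2) fun I =>
    ∑ J ∈ Finset.piAntidiag Finset.univ (∑ i, I i),
      vCoeff I J • (⟨lamMon J, Submodule.subset_span ⟨J, rfl⟩⟩ : LambdaLen k)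

end SingerTransfer

end

noncomputable section

namespace SingerTransfer

open Finset HahnSeries

/-! Let Φ (`sqHom`) be the ring homomorphism x_i ↦ x_{i+1}(x_{i+1} + x_1). In characteristic 2 it
sends a linear form ℓ to ℓ'(ℓ' + x_1), with ℓ' the shifted form, so it pairs the factors of V_{m+1}
according to whether x_1 occurs. Hence Φ(V_m) = V_{m+1} and v_{m+1} = Φ(v_m)/x_1 (`smallv_succ`), so
that v^J is x_1^{j_1 - (j_2 + ⋯ + j_k)} times Φ of the product of v_m^{j_{m+1}} in one variable
fewer.

The coefficient of x^I in Φ(x^K), in the power of x_1 that the degree allows, is ∏ binom(K_i, I_i -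
K_i): exactly the coefficient of x^I in Sq^{|I|-|K|} x^K. Homogeneity of v^J makes the degree of the
square j_1 - t_1, which gives `vCoeff_cons`; summing over J yields (1). No relation of Λ is used.
Parts (2)–(4) iterate (1) with the dual squares written out (`SqStar_aMon`).

The technical work is to define Φ on series with infinite support and negative exponents. It is
given coefficientwise in a variable T, shown multiplicative by Vandermonde, and followed by T = x_1.
-/

/-! ### The substitution x_i ↦ x_i^2 + x_i T on Laurent series -/

theorem coeff_mul_of_support_subset {Γ R : Type*} [AddCommMonoid Γ] [PartialOrder Γ]
    [IsOrderedCancelAddMonoid Γ] [Semiring R] {x y : HahnSeries Γ R} {s t : Set Γ}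
    (hs : s.IsPWO) (ht : t.IsPWO) (hxs : x.support ⊆ s) (hyt : y.support ⊆ t) (a : Γ) :
    (x * y).coeff a = ∑ p ∈ Finset.antidiagonal hs ht a, x.coeff p.1 * y.coeff p.2 := by
  rw [coeff_mul]
  refine sum_subset (fun p hp => ?_) fun p hp hp' => ?_
  · rw [Finset.mem_antidiagonal] at hp ⊢
    exact ⟨hxs hp.1, hyt hp.2.1, hp.2.2⟩
  · rw [Finset.mem_antidiagonal] at hp hp'
    by_contra h
    exact hp' ⟨left_ne_zero_of_mul h, right_ne_zero_of_mul h, hp.2.2⟩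

/-- The operator `x ^ K ↦ (∏ i, (K i).choose (n i)) x ^ K`. -/
def binomOp {k : ℕ} (n : Fin k → ℕ) : Laurent k →+ Laurent k where
  toFun f :=
    { coeff := fun K => ((∏ i, Ring.choose (ofLex K i) (n i) : ℤ) : ZMod 2) * f.coeff K
      isPWO_support' := f.isPWO_support.mono fun _ hK => right_ne_zero_of_mul hK }
  map_zero' := by ext; simp
  map_add' f g := by ext; simp [mul_add]

theorem coeff_binomOp {k : ℕ} (n : Fin k → ℕ) (f : Laurent k) (K : Lex (Fin k → ℤ)) :
    (binomOp n f).coeff K =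
      ((∏ i, Ring.choose (ofLex K i) (n i) : ℤ) : ZMod 2) * f.coeff K := rfl

theorem support_binomOp_subset {k : ℕ} (n : Fin k → ℕ) (f : Laurent k) :
    (binomOp n f).support ⊆ f.support := fun _ hK => right_ne_zero_of_mul hK

/-- Exponents add under multiplication, so this is the Vandermonde identity for `Ring.choose` in
each coordinate. It holds for all integers, hence for negative exponents too. -/
theorem binomOp_mul {k : ℕ} (n : Fin k → ℕ) (f g : Laurent k) :
    binomOp n (f * g) = ∑ p ∈ Fintype.piFinset fun i => antidiagonal (n i),
      binomOp (fun i => (p i).1) f * binomOp (fun i => (p i).2) g := by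
  ext a
  simp only [coeff_binomOp, HahnSeries.coeff_sum]
  -- The supports of the factors depend on `p`; indexing every product by the supports of `f` and
  -- `g` allows the two sums to be swapped.
  simp_rw [fun (p : Fin k → ℕ × ℕ) => coeff_mul_of_support_subset f.isPWO_support g.isPWO_support
    (support_binomOp_subset (fun i => (p i).1) f) (support_binomOp_subset (fun i => (p i).2) g) a]
  rw [sum_comm, coeff_mul, mul_sum]
  refine sum_congr rfl fun q hq => ?_
  rw [Finset.mem_antidiagonal] at hq
  have h : ∏ i, Ring.choose (ofLex a i) (n i) =
      ∑ p ∈ Fintype.piFinset fun i => antidiagonal (n i),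
        (∏ i, Ring.choose (ofLex q.1 i) (p i).1) * ∏ i, Ring.choose (ofLex q.2 i) (p i).2 := by
    simp_rw [← prod_mul_distrib]
    rw [← prod_univ_sum (fun i => antidiagonal (n i)) fun i p =>
      Ring.choose (ofLex q.1 i) p.1 * Ring.choose (ofLex q.2 i) p.2]
    refine prod_congr rfl fun i _ => ?_
    rw [← Ring.add_choose_eq _ (Commute.all _ _), ← hq.2.2]
    rfl
  rw [h, Int.cast_sum, sum_mul]
  refine sum_congr rfl fun p _ => ?_
  simp only [coeff_binomOp, Int.cast_mul]
  ring

theorem binomOp_single {k : ℕ} (n : Fin k → ℕ) (K : Lex (Fin k → ℤ)) (r : ZMod 2) :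
    binomOp n (single K r) =
      single K (((∏ i, Ring.choose (ofLex K i) (n i) : ℤ) : ZMod 2) * r) := by
  ext M
  rw [coeff_binomOp]
  by_cases h : M = K
  · subst h; simp
  · simp [coeff_single_of_ne h]

theorem double_strictMono (k : ℕ) :
    StrictMono (nsmulAddMonoidHom (α := Lex (Fin k → ℤ)) 2) := fun a b h => by
  simpa only [nsmulAddMonoidHom_apply, two_nsmul] using add_lt_add h h

/-- The ring homomorphism `x ^ K ↦ x ^ (2 K)`. -/
def double (k : ℕ) : Laurent k →+* Laurent k :=
  embDomainRingHom (nsmulAddMonoidHom 2) (double_strictMono k).injective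
    fun _ _ => (double_strictMono k).le_iff_le

theorem coeff_double {k : ℕ} (f : Laurent k) (K : Lex (Fin k → ℤ)) :
    (double k f).coeff (2 • K) = f.coeff K :=
  embDomain_mk_coeff (double_strictMono k).injective (fun _ _ => (double_strictMono k).le_iff_le)

theorem coeff_double_of_notMem {k : ℕ} (f : Laurent k) (M : Lex (Fin k → ℤ))
    (h : ∀ K : Lex (Fin k → ℤ), 2 • K ≠ M) : (double k f).coeff M = 0 :=
  embDomain_of_notMem_range (by rintro ⟨K, hK⟩; exact h K hK)

theorem double_single {k : ℕ} (K : Lex (Fin k → ℤ)) (r : ZMod 2) :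
    double k (single K r) = single (2 • K) r := embDomain_single

/-- The coefficient of `T ^ e` in the image of `f` under `x_i ↦ x_i ^ 2 + x_i T`. -/
def sqCoeff {k : ℕ} (e : ℕ) (f : Laurent k) : Laurent k :=
  ∑ n ∈ Nat.antidiagonalTuple k e,
    single (toLex fun i => -(n i : ℤ)) 1 * double k (binomOp n f)

/-- A pair of tuples can be grouped by its entrywise sum, as Vandermonde produces it, or by its two
totals, as the Cauchy product in T requires. -/
theorem sum_antidiagonalTuple_piFinset {k : ℕ} {M : Type*} [AddCommMonoid M] (e : ℕ)
    (G : (Fin k → ℕ) → (Fin k → ℕ) → M) :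
    ∑ n ∈ Nat.antidiagonalTuple k e, ∑ p ∈ Fintype.piFinset fun i => antidiagonal (n i),
        G (fun i => (p i).1) (fun i => (p i).2) =
      ∑ c ∈ antidiagonal e, ∑ a ∈ Nat.antidiagonalTuple k c.1,
        ∑ b ∈ Nat.antidiagonalTuple k c.2, G a b := by
  simp_rw [← sum_product', sum_sigma']
  refine sum_bij'
    (fun x _ => ⟨(∑ i, (x.2 i).1, ∑ i, (x.2 i).2), (fun i => (x.2 i).1, fun i => (x.2 i).2)⟩)
    (fun y _ => ⟨fun i => y.2.1 i + y.2.2 i, fun i => (y.2.1 i, y.2.2 i)⟩) ?_ ?_ ?_ ?_ ?_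
  · rintro ⟨n, p⟩ h
    simp only [mem_sigma, Nat.mem_antidiagonalTuple, Fintype.mem_piFinset,
      HasAntidiagonal.mem_antidiagonal, mem_product, and_true] at h ⊢
    change _ + _ = e
    rw [← h.1, ← sum_add_distrib]
    exact sum_congr rfl fun i _ => h.2 i
  · rintro ⟨c, p⟩ h
    simp only [mem_sigma, Nat.mem_antidiagonalTuple, Fintype.mem_piFinset,
      HasAntidiagonal.mem_antidiagonal, mem_product, implies_true, and_true] at h ⊢
    rw [sum_add_distrib, h.2.1, h.2.2, h.1]
  · rintro ⟨n, p⟩ h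
    simp only [mem_sigma, Fintype.mem_piFinset, HasAntidiagonal.mem_antidiagonal] at h
    simp [h.2]
  · rintro ⟨c, p⟩ h
    simp only [mem_sigma, Nat.mem_antidiagonalTuple, mem_product] at h
    simp [h.2]
  · rintro ⟨n, p⟩ _
    rfl

theorem sqCoeff_mul {k : ℕ} (e : ℕ) (f g : Laurent k) :
    sqCoeff e (f * g) = ∑ c ∈ antidiagonal e, sqCoeff c.1 f * sqCoeff c.2 g := by
  simp only [sqCoeff, sum_mul_sum, binomOp_mul, map_sum]
  simp only [mul_sum]
  rw [← sum_antidiagonalTuple_piFinset e fun a b =>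
    (single (toLex fun i => -(a i : ℤ)) 1 * double k (binomOp a f)) *
      (single (toLex fun i => -(b i : ℤ)) 1 * double k (binomOp b g))]
  refine sum_congr rfl fun n _ => sum_congr rfl fun p hp => ?_
  rw [Fintype.mem_piFinset] at hp
  have h : (toLex fun i => -(n i : ℤ)) =
      (toLex fun i => -((p i).1 : ℤ)) + toLex fun i => -((p i).2 : ℤ) := by
    rw [← toLex_add]
    congr 1
    ext i
    rw [← HasAntidiagonal.mem_antidiagonal.1 (hp i)]
    push_cast [Pi.add_apply]
    ring
  rw [mul_mul_mul_comm, single_mul_single, map_mul, h, one_mul]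

theorem sqCoeff_add {k : ℕ} (e : ℕ) (f g : Laurent k) :
    sqCoeff e (f + g) = sqCoeff e f + sqCoeff e g := by
  simp [sqCoeff, mul_add, sum_add_distrib]

theorem sqCoeff_single {k : ℕ} (e : ℕ) (K : Lex (Fin k → ℤ)) :
    sqCoeff e (single K (1 : ZMod 2)) = ∑ n ∈ Nat.antidiagonalTuple k e,
      single ((toLex fun i => -(n i : ℤ)) + 2 • K)
        ((∏ i, Ring.choose (ofLex K i) (n i) : ℤ) : ZMod 2) := by
  simp [sqCoeff, binomOp_single, double_single, single_mul_single]

theorem sqCoeff_one {k : ℕ} (e : ℕ) :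
    sqCoeff e (1 : Laurent k) = if e = 0 then 1 else 0 := by
  rw [← single_zero_one, sqCoeff_single]
  split_ifs with h
  · subst h
    rw [Nat.antidiagonalTuple_zero_right, sum_singleton]
    simp
    rfl
  · refine sum_eq_zero fun n hn => ?_
    rw [Nat.mem_antidiagonalTuple] at hn
    obtain ⟨i, hi⟩ : ∃ i, n i ≠ 0 := by
      by_contra! H
      exact h (by rw [← hn]; simp [H])
    rw [prod_eq_zero (mem_univ i), Int.cast_zero, single_eq_zero]
    exact Ring.choose_zero_pos ℤ (Nat.pos_of_ne_zero hi)

theorem sqCoeff_xvar {k : ℕ} (e : ℕ) (i : Fin k) :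
    sqCoeff e (xvar i) = if e = 0 then xvar i ^ 2 else if e = 1 then xvar i else 0 := by
  have hx : (xvar i : Laurent k) = single (toLex (Pi.single i 1)) 1 := rfl
  have hc : ∀ m : ℕ, Ring.choose (1 : ℤ) m = Nat.choose 1 m := fun m => by
    exact_mod_cast Ring.choose_natCast (R := ℤ) 1 m
  -- Away from `i` the exponent is 0 and `Ring.choose 0 m = 0` for `m > 0`, so only the tuple with
  -- all of `e` at `i` survives.
  rw [hx, sqCoeff_single, sum_eq_single (Pi.single i e)]
  · have hp : ∏ j, Ring.choose (ofLex (toLex (Pi.single i (1 : ℤ) : Fin k → ℤ)) j)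
        ((Pi.single i e : Fin k → ℕ) j) = Nat.choose 1 e := by
      rw [prod_eq_single i]
      · simp [hc]
      · intro j _ hj
        simp [hj]
      · simp
    have hK : (toLex fun j => -((Pi.single i e : Fin k → ℕ) j : ℤ)) +
        2 • toLex (Pi.single i (1 : ℤ) : Fin k → ℤ) = (2 - e : ℤ) • toLex (Pi.single i 1) := by
      rw [← natCast_zsmul, sub_smul, sub_eq_neg_add]
      congr 1
      apply ofLex.injective
      ext j
      change -((Pi.single i e : Fin k → ℕ) j : ℤ) = -((e : ℤ) • (Pi.single i (1 : ℤ) : Fin k → ℤ) j)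
      by_cases h : j = i
      · subst h; simp
      · simp [h]
    rw [hp, hK]
    split_ifs with h0 h1
    · subst h0
      rw [single_pow]
      simp
    · subst h1
      simp
    · rw [Nat.choose_eq_zero_of_lt (by omega)]
      simp
  · intro n hn hne
    rw [Nat.mem_antidiagonalTuple] at hn
    obtain ⟨j, hj, hj0⟩ : ∃ j, j ≠ i ∧ n j ≠ 0 := by
      by_contra! H
      apply hne
      ext j
      by_cases h : j = i
      · subst h
        rw [← hn, sum_eq_single j (fun l _ hl => H l hl) (by simp)]
        simp
      · simp [h, H j h]
    rw [prod_eq_zero (mem_univ j), Int.cast_zero, single_eq_zero]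
    simpa [hj] using Ring.choose_zero_pos ℤ (Nat.pos_of_ne_zero hj0)
  · intro h
    exact absurd (Nat.mem_antidiagonalTuple.2 (by simp)) h

/-- The ring homomorphism `x_i ↦ x_i ^ 2 + x_i T`. -/
def sqSeries (k : ℕ) : Laurent k →+* PowerSeries (Laurent k) where
  toFun f := PowerSeries.mk fun e => sqCoeff e f
  map_one' := by ext1 e; simp [sqCoeff_one, PowerSeries.coeff_one]
  map_mul' f g := by ext1 e; simp [sqCoeff_mul, PowerSeries.coeff_mul]
  map_zero' := by ext1 e; simp [sqCoeff]
  map_add' f g := by ext1 e; simp [sqCoeff_add]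

theorem sqSeries_xvar {k : ℕ} (i : Fin k) :
    sqSeries k (xvar i) =
      PowerSeries.C (xvar i) ^ 2 + PowerSeries.C (xvar i) * PowerSeries.X := by
  ext1 e
  rw [← map_pow, map_add, PowerSeries.coeff_C, PowerSeries.coeff_C_mul, PowerSeries.coeff_X,
    sqSeries, RingHom.coe_mk, MonoidHom.coe_mk, OneHom.coe_mk, PowerSeries.coeff_mk, sqCoeff_xvar]
  rcases e with _ | _ | e <;> simp

/-! ### Adjoining x_1: power series in T as Laurent series in one more variable -/

/-- Both sides sum over quadruples of exponents, and the index sets agree because a nonzero inner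
coefficient forces the outer one to be nonzero. -/
theorem ofIterate_mul {Γ Γ' R : Type*} [AddCommGroup Γ] [LinearOrder Γ] [IsOrderedAddMonoid Γ]
    [AddCommGroup Γ'] [LinearOrder Γ'] [IsOrderedAddMonoid Γ'] [CommRing R]
    (x y : HahnSeries Γ (HahnSeries Γ' R)) :
    ofIterate (x * y) = ofIterate x * ofIterate y := by
  ext ⟨a, b⟩
  change ((x * y).coeff a).coeff b = (ofIterate x * ofIterate y).coeff (toLex (a, b))
  rw [HahnSeries.coeff_mul, HahnSeries.coeff_mul, HahnSeries.coeff_sum]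
  simp_rw [HahnSeries.coeff_mul]
  rw [sum_sigma']
  refine sum_bij'
    (fun p _ => (toLex (p.1.1, p.2.1), toLex (p.1.2, p.2.2)))
    (fun q _ => ⟨((ofLex q.1).1, (ofLex q.2).1), ((ofLex q.1).2, (ofLex q.2).2)⟩)
    ?_ ?_ ?_ ?_ ?_
  · rintro ⟨⟨c, d⟩, ⟨e, f⟩⟩ h
    simp only [mem_sigma, Finset.mem_antidiagonal] at h ⊢
    refine ⟨h.2.1, h.2.2.1, ?_⟩
    rw [← h.1.2.2, ← h.2.2.2]
    rfl
  · rintro ⟨⟨c, d⟩, ⟨e, f⟩⟩ h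
    simp only [mem_sigma, Finset.mem_antidiagonal] at h ⊢
    have h3 : (c + e, d + f) = (a, b) := h.2.2
    have hx : (x.coeff c).coeff d ≠ 0 := h.1
    have hy : (y.coeff e).coeff f ≠ 0 := h.2.1
    refine ⟨⟨?_, ?_, congrArg Prod.fst h3⟩, hx, hy, congrArg Prod.snd h3⟩
    · intro h0
      exact hx (congrFun (congrArg HahnSeries.coeff h0) d)
    · intro h0
      exact hy (congrFun (congrArg HahnSeries.coeff h0) f)
  · rintro ⟨⟨c, d⟩, ⟨e, f⟩⟩ h
    rfl
  · rintro ⟨⟨c, d⟩, ⟨e, f⟩⟩ h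
    rfl
  · rintro ⟨⟨c, d⟩, ⟨e, f⟩⟩ h
    rfl

theorem ofIterate_one {Γ Γ' R : Type*} [AddCommGroup Γ] [LinearOrder Γ] [IsOrderedAddMonoid Γ]
    [AddCommGroup Γ'] [LinearOrder Γ'] [IsOrderedAddMonoid Γ'] [CommRing R] :
    ofIterate (1 : HahnSeries Γ (HahnSeries Γ' R)) = 1 := by
  ext ⟨a, b⟩
  change ((1 : HahnSeries Γ (HahnSeries Γ' R)).coeff a).coeff b =
    (1 : HahnSeries (Γ ×ₗ Γ') R).coeff (toLex (a, b))
  have : toLex (a, b) = 0 ↔ a = 0 ∧ b = 0 := Prod.mk_eq_zero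
  rw [coeff_one, coeff_one]
  simp only [this]
  by_cases ha : a = 0
  · simp [ha, coeff_one]
  · simp [ha]

/-- The exponent of `x_1 ^ e` times the monomial in `x_2, …, x_{k+1}` with exponent `K`. -/
def lexCons (k : ℕ) : ℤ ×ₗ Lex (Fin k → ℤ) →+ Lex (Fin (k + 1) → ℤ) where
  toFun p := toLex (Fin.cons (ofLex p).1 (ofLex (ofLex p).2))
  map_zero' := by
    apply ofLex.injective
    ext i
    refine Fin.cases rfl (fun j => rfl) i
  map_add' p q := by
    apply ofLex.injective
    ext i
    refine Fin.cases rfl (fun j => rfl) i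

/-- The exponent of x_1 is compared first in both orders. This is why expanding in powers of T
agrees with the prescribed iterated Laurent expansion. -/
theorem lexCons_strictMono (k : ℕ) : StrictMono (lexCons k) := fun p q h => by
  have h' := Prod.Lex.lt_iff.1 h
  exact (Fin.pi_lex_lt_cons_cons (α := fun _ => ℤ) (s := fun {_} a b => a < b)).2 h'

/-- Power series in `x_1` over the Laurent series in the remaining variables, as Laurent series. -/
def ofSeries (k : ℕ) : PowerSeries (Laurent k) →+* Laurent (k + 1) where
  toFun F := embDomainRingHom (lexCons k) (lexCons_strictMono k).injective
    (fun _ _ => (lexCons_strictMono k).le_iff_le) (ofIterate (ofPowerSeries ℤ (Laurent k) F))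
  map_one' := by
    rw [map_one, ofIterate_one, map_one]
  map_mul' F G := by rw [map_mul, ofIterate_mul, map_mul]
  map_zero' := by
    rw [map_zero]
    exact map_zero _
  map_add' F G := by
    rw [map_add]
    exact map_add _ (ofIterate (ofPowerSeries ℤ (Laurent k) F))
      (ofIterate (ofPowerSeries ℤ (Laurent k) G))

theorem coeff_ofSeries {k : ℕ} (F : PowerSeries (Laurent k)) (e : ℤ) (K : Fin k → ℤ) :
    (ofSeries k F).coeff (toLex (Fin.cons e K)) =
      if 0 ≤ e then (PowerSeries.coeff e.toNat F).coeff (toLex K) else 0 := by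
  refine (embDomain_mk_coeff (lexCons_strictMono k).injective
    (fun _ _ => (lexCons_strictMono k).le_iff_le) (a := toLex (e, toLex K))).trans ?_
  change ((ofPowerSeries ℤ (Laurent k) F).coeff e).coeff (toLex K) = _
  split_ifs with h
  · lift e to ℕ using h
    have := ofPowerSeries_apply_coeff (Γ := ℤ) F e
    rw [this]
    rfl
  · rw [ofPowerSeries_apply, embDomain_of_notMem_range, HahnSeries.coeff_zero]
    rintro ⟨n, hn⟩
    apply h
    rw [← hn]
    exact Int.natCast_nonneg n

theorem ofSeries_X (k : ℕ) : ofSeries k PowerSeries.X = xvar 0 := by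
  ext M
  obtain ⟨e, K, rfl⟩ : ∃ (e : ℤ) (K : Fin k → ℤ), M = toLex (Fin.cons e K) :=
    ⟨ofLex M 0, Fin.tail (ofLex M), by rw [Fin.cons_self_tail]; rfl⟩
  have hM : toLex (Fin.cons e K : Fin (k + 1) → ℤ) = toLex (Pi.single 0 1) ↔ e = 1 ∧ K = 0 := by
    rw [toLex_inj, ← Fin.cons_self_tail (Pi.single 0 1 : Fin (k + 1) → ℤ), Fin.cons_inj]
    simp [Fin.tail_def, funext_iff]
  rw [coeff_ofSeries, PowerSeries.coeff_X, xvar, coeff_single]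
  simp only [hM]
  have h1 : toLex K = 0 ↔ K = 0 := Iff.rfl
  by_cases he : e = 1
  · subst he
    simp [coeff_one, h1]
  · have : e.toNat = 1 ↔ e = 1 := by omega
    simp [he, this]

theorem ofSeries_C_xvar {k : ℕ} (i : Fin k) :
    ofSeries k (PowerSeries.C (xvar i)) = xvar i.succ := by
  ext M
  obtain ⟨e, K, rfl⟩ : ∃ (e : ℤ) (K : Fin k → ℤ), M = toLex (Fin.cons e K) :=
    ⟨ofLex M 0, Fin.tail (ofLex M), by rw [Fin.cons_self_tail]; rfl⟩
  have hM : toLex (Fin.cons e K : Fin (k + 1) → ℤ) = toLex (Pi.single i.succ 1) ↔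
      e = 0 ∧ K = Pi.single i 1 := by
    rw [toLex_inj, ← Fin.cons_self_tail (Pi.single i.succ 1 : Fin (k + 1) → ℤ), Fin.cons_inj]
    have : Fin.tail (Pi.single i.succ 1 : Fin (k + 1) → ℤ) = Pi.single i 1 := by
      ext j
      simp [Fin.tail_def, Pi.single_apply]
    rw [this]
    simp
  have h1 : toLex K = toLex (Pi.single i 1) ↔ K = Pi.single i 1 := Iff.rfl
  rw [coeff_ofSeries, PowerSeries.coeff_C, xvar, xvar, coeff_single]
  simp only [hM]
  by_cases he : e = 0
  · subst he
    simp [coeff_single, h1]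
  · by_cases h0 : 0 ≤ e
    · have : e.toNat ≠ 0 := by omega
      simp [he, this]
    · simp [he, h0]

/-! ### The recursion for the invariants V_m and v_m -/

/-- The ring homomorphism `x_i ↦ x_{i+1} ^ 2 + x_{i+1} x_1`. -/
def sqHom (k : ℕ) : Laurent k →+* Laurent (k + 1) := (ofSeries k).comp (sqSeries k)

theorem sqHom_xvar {k : ℕ} (i : Fin k) :
    sqHom k (xvar i) = xvar i.succ ^ 2 + xvar i.succ * xvar 0 := by
  rw [sqHom, RingHom.comp_apply, sqSeries_xvar, map_add, map_mul, map_pow, ofSeries_X,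
    ofSeries_C_xvar]

theorem coeff_sqHom {k : ℕ} (f : Laurent k) (e : ℤ) (M : Fin k → ℤ) :
    (sqHom k f).coeff (toLex (Fin.cons e M)) =
      if 0 ≤ e then (sqCoeff e.toNat f).coeff (toLex M) else 0 := by
  rw [sqHom, RingHom.comp_apply, coeff_ofSeries, sqSeries, RingHom.coe_mk, MonoidHom.coe_mk,
    OneHom.coe_mk, PowerSeries.coeff_mk]

instance (k : ℕ) : CharP (Laurent k) 2 :=
  charP_of_injective_ringHom (HahnSeries.C_injective (Γ := Lex (Fin k → ℤ)) (R := ZMod 2)) 2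

/-- The map y ↦ y^2 + y x_1 = y (y + x_1) is additive in characteristic 2, so a linear form splits
in the same way as a variable does. -/
theorem sqHom_add_sum {k : ℕ} (m : Fin k) (S : Finset (Fin k)) :
    sqHom k (xvar m + ∑ j ∈ S, xvar j) =
      (xvar m.succ + ∑ j ∈ S, xvar j.succ) *
        (xvar m.succ + (xvar 0 + ∑ j ∈ S, xvar j.succ)) := by
  rw [map_add, map_sum]
  simp only [sqHom_xvar, sum_add_distrib, ← sum_mul, ← sum_pow_char 2]
  linear_combination (-(xvar m.succ * ∑ j ∈ S, xvar j.succ)) *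
    (CharTwo.two_eq_zero : (2 : Laurent (k + 1)) = 0)

theorem sqHom_bigV {k : ℕ} (m : Fin k) : sqHom k (bigV m) = bigV m.succ := by
  have hI : Iio m.succ = insert 0 ((Iio m).map (Fin.succEmb k)) := by
    ext i
    refine Fin.cases ?_ (fun j => ?_) i <;> simp
  have h0 : (0 : Fin (k + 1)) ∉ (Iio m).map (Fin.succEmb k) := by simp
  -- Subsets of the indices below `m.succ` come in pairs, without and with `0`; each pair gives the
  -- two factors in the image of one factor of `bigV m`.
  rw [bigV, bigV, hI, prod_powerset_insert h0, ← prod_mul_distrib, map_prod]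
  have hp : ((Iio m).map (Fin.succEmb k)).powerset =
      (Iio m).powerset.map (mapEmbedding (Fin.succEmb k)).toEmbedding := by
    ext S
    simp only [mem_powerset, mem_map, RelEmbedding.coe_toEmbedding, mapEmbedding_apply]
    rw [subset_map_iff]
    simp [eq_comm]
  rw [hp, prod_map]
  refine prod_congr rfl fun S _ => ?_
  rw [sqHom_add_sum, RelEmbedding.coe_toEmbedding, mapEmbedding_apply, sum_insert (by simp),
    sum_map]
  rfl

theorem bigV_zero {k : ℕ} : bigV (0 : Fin (k + 1)) = xvar 0 := by
  have : Iio (0 : Fin (k + 1)) = ∅ := by ext; simp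
  simp [bigV, this]

theorem smallv_zero {k : ℕ} : smallv (0 : Fin (k + 1)) = xvar 0 := by
  have : Iio (0 : Fin (k + 1)) = ∅ := by ext; simp
  simp [smallv, this, bigV_zero]

/-- All V's in numerator and denominator are shifted by `sqHom_bigV`; the only factor not reached by
the shift is V_1 = x_1 in the denominator. -/
theorem smallv_succ {k : ℕ} (m : Fin k) :
    smallv m.succ = sqHom k (smallv m) * (xvar 0)⁻¹ := by
  have hI : Iio m.succ = insert 0 ((Iio m).map (Fin.succEmb k)) := by
    ext i
    refine Fin.cases ?_ (fun j => ?_) i <;> simp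
  have h0 : (0 : Fin (k + 1)) ∉ (Iio m).map (Fin.succEmb k) := by simp
  rw [smallv, smallv, hI, prod_insert h0, prod_map, map_div₀, map_prod, bigV_zero]
  simp only [sqHom_bigV, Fin.coe_succEmb]
  rw [div_eq_mul_inv, div_eq_mul_inv, mul_inv]
  ring

/-! ### Coefficients of `sqHom` at monomials with non-negative exponents -/

theorem coeff_sqCoeff {k : ℕ} (e : ℕ) (f : Laurent k) (M : Fin k → ℤ) :
    (sqCoeff e f).coeff (toLex M) = ∑ n ∈ Nat.antidiagonalTuple k e,
      (double k (binomOp n f)).coeff (toLex fun i => M i + n i) := by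
  rw [sqCoeff, HahnSeries.coeff_sum]
  refine sum_congr rfl fun n _ => ?_
  rw [coeff_single_mul, one_mul]
  congr 1
  apply ofLex.injective
  ext i
  change M i - -(n i : ℤ) = M i + n i
  ring

/-- Only exponents with `2 K = I + n` contribute, and these are non-negative because `I` and `n`
are. So terms of `f` with a negative exponent play no part, although `f` may have them. Symmetry of
the binomial replaces `n i` by `K i - n i = I i - K i`. -/
theorem coeff_double_binomOp {k : ℕ} (n : Fin k → ℕ) (f : Laurent k) (I : Fin k →₀ ℕ) :
    (double k (binomOp n f)).coeff (toLex fun i => (I i : ℤ) + n i) =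
      ∑ K ∈ Iic I, if ∀ i, 2 * K i = I i + n i then
        ((∏ i, (K i).choose (I i - K i) : ℕ) : ZMod 2) * f.coeff (toLex fun i => (K i : ℤ)) else 0 := by
  by_cases h : ∃ K : Fin k →₀ ℕ, ∀ i, 2 * K i = I i + n i
  · obtain ⟨K, hK⟩ := h
    have hM : (toLex fun i => (I i : ℤ) + n i) = 2 • toLex fun i => (K i : ℤ) := by
      apply ofLex.injective
      ext i
      change (I i : ℤ) + n i = 2 • (K i : ℤ)
      have := hK i
      simp only [nsmul_eq_mul]
      push_cast
      omega
    have hu : ∀ L : Fin k →₀ ℕ, (∀ i, 2 * L i = I i + n i) → L = K := fun L hL => by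
      ext i
      have := hL i
      have := hK i
      omega
    have hc : ((∏ i, Ring.choose (K i : ℤ) (n i) : ℤ) : ZMod 2) =
        ((∏ i, (K i).choose (n i) : ℕ) : ZMod 2) := by
      simp_rw [Ring.choose_natCast]
      push_cast
      rfl
    rw [hM, coeff_double, coeff_binomOp]
    change ((∏ i, Ring.choose (K i : ℤ) (n i) : ℤ) : ZMod 2) * _ = _
    rw [hc]
    by_cases hKI : K ≤ I
    · rw [sum_eq_single_of_mem K (mem_Iic.2 hKI) fun L _ hL => if_neg fun h => hL (hu L h),
        if_pos hK]
      congr 2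
      refine prod_congr rfl fun i _ => ?_
      have := hK i
      have := hKI i
      rw [← Nat.choose_symm (by omega)]
      congr 1
      omega
    -- Here `n i = 2 * K i - I i > K i`, so the binomial vanishes.
    · obtain ⟨i, hi⟩ : ∃ i, I i < K i := by
        by_contra! H
        exact hKI H
      have := hK i
      rw [prod_eq_zero (mem_univ i) (Nat.choose_eq_zero_of_lt (by omega)), Nat.cast_zero, zero_mul,
        sum_eq_zero]
      intro L hL
      refine if_neg fun h => hKI ?_
      rw [← hu L h]
      exact mem_Iic.1 hL
  · rw [sum_eq_zero fun L _ => if_neg fun hL => h ⟨L, hL⟩, coeff_double_of_notMem]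
    intro K hK
    have hK' : ∀ i, 2 * ofLex K i = I i + n i := fun i => by
      have := congrFun (congrArg ofLex hK) i
      change 2 • ofLex K i = _ at this
      simpa using this
    refine h ⟨Finsupp.equivFunOnFinite.symm fun i => (ofLex K i).toNat, fun i => ?_⟩
    have := hK' i
    simp only [Finsupp.equivFunOnFinite_symm_apply_apply]
    omega

theorem coeff_sqHom_natCast {k : ℕ} (f : Laurent k) (e : ℤ) (I : Fin k →₀ ℕ) :
    (sqHom k f).coeff (toLex (Fin.cons e fun i => (I i : ℤ))) =
      ∑ K ∈ Iic I, if 2 * ∑ i, (K i : ℤ) = ∑ i, (I i : ℤ) + e then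
        ((∏ i, (K i).choose (I i - K i) : ℕ) : ZMod 2) * f.coeff (toLex fun i => (K i : ℤ)) else 0 := by
  rw [coeff_sqHom]
  split_ifs with he
  · lift e to ℕ using he
    simp only [Int.toNat_natCast]
    rw [coeff_sqCoeff]
    simp_rw [coeff_double_binomOp]
    rw [sum_comm]
    refine sum_congr rfl fun K hK => ?_
    -- If this holds, `n = 2 K - I` is the only possible tuple; if it fails at `i`, then `I i - K i
    -- > K i` and the binomial is zero.
    by_cases hle : ∀ i, I i ≤ 2 * K i
    · have hiff : ∀ n : Fin k → ℕ, (∀ i, 2 * K i = I i + n i) ↔ n = fun i => 2 * K i - I i := by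
        intro n
        rw [funext_iff]
        refine forall_congr' fun i => ?_
        have := hle i
        omega
      simp only [hiff, sum_ite_eq', Nat.mem_antidiagonalTuple]
      congr 1
      have : ((∑ i, (2 * K i - I i) : ℕ) : ℤ) = 2 * ∑ i, (K i : ℤ) - ∑ i, (I i : ℤ) := by
        rw [mul_sum, ← sum_sub_distrib]
        push_cast [hle]
        rfl
      rw [eq_iff_iff]
      omega
    · push Not at hle
      obtain ⟨i, hi⟩ := hle
      rw [prod_eq_zero (mem_univ i) (Nat.choose_eq_zero_of_lt (by omega))]
      simp
  -- For negative `e` the degree condition forces `I i > 2 * K i` for some `i`, and the binomial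
  -- vanishes again.
  · refine (sum_eq_zero fun K _ => ?_).symm
    rw [ite_eq_right_iff]
    intro h
    obtain ⟨i, hi⟩ : ∃ i, 2 * K i < I i := by
      by_contra! H
      have : ∑ i, (I i : ℤ) ≤ 2 * ∑ i, (K i : ℤ) := by
        rw [mul_sum]
        exact sum_le_sum fun i _ => by exact_mod_cast H i
      omega
    rw [prod_eq_zero (mem_univ i) (Nat.choose_eq_zero_of_lt (by omega))]
    simp

/-! ### Homogeneity of v^J -/

/-- The Laurent series `f` is homogeneous of degree `d`. -/
def IsHomog {k : ℕ} (d : ℤ) (f : Laurent k) : Prop :=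
  ∀ K : Lex (Fin k → ℤ), f.coeff K ≠ 0 → ∑ i, ofLex K i = d

theorem isHomog_single {k : ℕ} (K : Lex (Fin k → ℤ)) (r : ZMod 2) :
    IsHomog (∑ i, ofLex K i) (single K r) := fun M hM => by
  by_cases h : M = K
  · rw [h]
  · exact absurd (coeff_single_of_ne h) hM

theorem IsHomog.mul {k : ℕ} {d d' : ℤ} {f g : Laurent k} (hf : IsHomog d f) (hg : IsHomog d' g) :
    IsHomog (d + d') (f * g) := fun K hK => by
  rw [HahnSeries.coeff_mul] at hK
  obtain ⟨p, hp, -⟩ := exists_ne_zero_of_sum_ne_zero hK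
  rw [Finset.mem_antidiagonal] at hp
  rw [← hf _ hp.1, ← hg _ hp.2.1, ← hp.2.2, ← sum_add_distrib]
  rfl

theorem isHomog_one {k : ℕ} : IsHomog 0 (1 : Laurent k) := by
  convert isHomog_single (0 : Lex (Fin k → ℤ)) 1 using 1
  · exact sum_const_zero.symm
  · rfl

theorem IsHomog.pow {k : ℕ} {d : ℤ} {f : Laurent k} (hf : IsHomog d f) (n : ℕ) :
    IsHomog (n * d) (f ^ n) := by
  induction n with
  | zero => simpa using isHomog_one
  | succ n ih =>
    rw [pow_succ]
    convert ih.mul hf using 1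
    push_cast
    ring

theorem isHomog_prod {k : ℕ} {ι : Type*} (s : Finset ι) (d : ι → ℤ) (f : ι → Laurent k)
    (h : ∀ i ∈ s, IsHomog (d i) (f i)) : IsHomog (∑ i ∈ s, d i) (∏ i ∈ s, f i) := by
  classical
  induction s using Finset.induction_on with
  | empty => simpa using isHomog_one
  | insert a s ha ih =>
    rw [sum_insert ha, prod_insert ha]
    exact (h a (mem_insert_self a s)).mul (ih fun i hi => h i (mem_insert_of_mem hi))

/-- Each variable goes to a form of degree 2; on exponents, `2 L = K + n` with `n` of total `e`, the
exponent of x_1. -/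
theorem IsHomog.sqHom {k : ℕ} {d : ℤ} {f : Laurent k} (hf : IsHomog d f) :
    IsHomog (2 * d) (sqHom k f) := fun M hM => by
  obtain ⟨e, K, rfl⟩ : ∃ (e : ℤ) (K : Fin k → ℤ), M = toLex (Fin.cons e K) :=
    ⟨ofLex M 0, Fin.tail (ofLex M), by rw [Fin.cons_self_tail]; rfl⟩
  rw [coeff_sqHom] at hM
  have he : 0 ≤ e := by
    by_contra h
    exact hM (if_neg h)
  rw [if_pos he, coeff_sqCoeff] at hM
  obtain ⟨n, hn, hne⟩ := exists_ne_zero_of_sum_ne_zero hM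
  rw [Nat.mem_antidiagonalTuple] at hn
  obtain ⟨L, hL⟩ : ∃ L : Lex (Fin k → ℤ), 2 • L = toLex fun i => K i + n i := by
    by_contra! H
    exact hne (coeff_double_of_notMem _ _ H)
  rw [← hL, coeff_double, coeff_binomOp] at hne
  have hd := hf L (right_ne_zero_of_mul hne)
  have hi : ∀ i, 2 * ofLex L i = K i + n i := fun i => by
    have := congrFun (congrArg ofLex hL) i
    change 2 • ofLex L i = _ at this
    simpa using this
  rw [ofLex_toLex, Fin.sum_univ_succ]
  simp only [Fin.cons_zero, Fin.cons_succ]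
  rw [← hd, mul_sum, sum_congr rfl fun i _ => hi i, sum_add_distrib]
  zify at hn
  omega

theorem xvar_zero_inv {k : ℕ} : (xvar (0 : Fin (k + 1)))⁻¹ =
    (single (toLex (Pi.single 0 (-1))) 1 : Laurent (k + 1)) := by
  refine inv_eq_of_mul_eq_one_right ?_
  rw [xvar, single_mul_single, ← toLex_add, ← Pi.single_add]
  simp

/-- Induction on the number of variables by `smallv_succ`: the degree doubles and division by x_1
lowers it by one, and 2 - 1 = 1. -/
theorem isHomog_smallv : ∀ {k : ℕ} (m : Fin k), IsHomog 1 (smallv m)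
  | k + 1, m => by
    refine Fin.cases ?_ (fun j => ?_) m
    · rw [smallv_zero]
      convert isHomog_single (toLex (Pi.single (0 : Fin (k + 1)) (1 : ℤ))) 1 using 1
      · simp
      · rfl
    · rw [smallv_succ, xvar_zero_inv]
      convert (isHomog_smallv j).sqHom.mul
        (isHomog_single (toLex (Pi.single (0 : Fin (k + 1)) (-1 : ℤ))) 1) using 1
      simp

theorem isHomog_prod_smallv {k : ℕ} (J : Fin k → ℕ) :
    IsHomog (∑ i, (J i : ℤ)) (∏ m, (smallv m : Laurent k) ^ J m) :=
  isHomog_prod _ _ _ fun i _ => by simpa using (isHomog_smallv i).pow (J i)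

theorem vCoeff_eq_zero {k : ℕ} {I : Fin k →₀ ℕ} {J : Fin k → ℕ} (h : ∑ i, I i ≠ ∑ i, J i) :
    vCoeff I J = 0 := by
  by_contra hne
  have := isHomog_prod_smallv J _ hne
  simp only [ofLex_toLex] at this
  exact h (by exact_mod_cast this)

/-! ### Steenrod squares on monomials and the recursion for the coefficients of v^J -/

/-- In the expansion of (x_i + x_i^2 T)^{K_i}, taking the second summand u_i times gives x_i^{K_i +
u_i} T^{u_i}; thus u = I - K. -/
theorem coeff_Sq_monomial_eq {k : ℕ} (s : ℕ) (I K : Fin k →₀ ℕ) :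
    MvPolynomial.coeff I (Sq s (MvPolynomial.monomial K (1 : ZMod 2))) =
      if K ≤ I ∧ ∑ i, I i = ∑ i, K i + s then
        ((∏ i, (K i).choose (I i - K i) : ℕ) : ZMod 2) else 0 := by
  have hT : totalSq k (MvPolynomial.monomial K (1 : ZMod 2)) =
      ∑ u ∈ Fintype.piFinset fun i => range (K i + 1),
        Polynomial.monomial (∑ i, u i) (MvPolynomial.monomial
          (K + Finsupp.equivFunOnFinite.symm u) ((∏ i, (K i).choose (u i) : ℕ) : ZMod 2)) := by
    have hK : MvPolynomial.monomial K (1 : ZMod 2) = ∏ i, MvPolynomial.X i ^ K i := by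
      rw [MvPolynomial.monomial_eq, map_one, one_mul,
        Finsupp.prod_fintype _ _ (fun i => pow_zero _)]
    rw [hK, map_prod]
    simp only [map_pow, totalSq, MvPolynomial.aeval_X]
    simp_rw [add_comm (Polynomial.C (MvPolynomial.X _)), add_pow]
    rw [prod_univ_sum]
    refine sum_congr rfl fun u hu => ?_
    rw [Fintype.mem_piFinset] at hu
    have hm : MvPolynomial.monomial (K + Finsupp.equivFunOnFinite.symm u)
        ((∏ i, (K i).choose (u i) : ℕ) : ZMod 2) =
        ∏ i, (MvPolynomial.X i ^ (K i + u i) * ((K i).choose (u i) : Cohomology k)) := by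
      rw [MvPolynomial.monomial_eq, Finsupp.prod_fintype _ _ (fun i => pow_zero _),
        prod_mul_distrib, mul_comm]
      simp
    rw [hm, ← Polynomial.C_mul_X_pow_eq_monomial, ← prod_pow_eq_pow_sum, map_prod,
      ← prod_mul_distrib]
    refine prod_congr rfl fun i _ => ?_
    have hle : u i ≤ K i := by
      have := mem_range.1 (hu i)
      omega
    have hs : K i + u i = 2 * u i + (K i - u i) := by omega
    rw [hs, _root_.pow_add, pow_mul]
    simp only [map_mul, map_pow, map_natCast]
    ring
  change MvPolynomial.coeff I ((totalSq k (MvPolynomial.monomial K (1 : ZMod 2))).coeff s) = _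
  rw [hT, Polynomial.finsetSum_coeff, MvPolynomial.coeff_sum]
  simp only [Polynomial.coeff_monomial, apply_ite (MvPolynomial.coeff I), MvPolynomial.coeff_zero,
    MvPolynomial.coeff_monomial]
  by_cases h : K ≤ I
  · have hadd : ∀ i, K i + (I i - K i) = I i := fun i => Nat.add_sub_cancel' (h i)
    rw [sum_eq_single fun i => I i - K i]
    · have h1 : K + Finsupp.equivFunOnFinite.symm (fun i => I i - K i) = I := by
        ext i
        simpa using hadd i
      have h2 : ∑ i, (I i - K i) = s ↔ ∑ i, I i = ∑ i, K i + s := by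
        have : ∑ i, I i = ∑ i, K i + ∑ i, (I i - K i) := by
          rw [← sum_add_distrib]
          exact sum_congr rfl fun i _ => (hadd i).symm
        omega
      rw [if_pos h1]
      simp only [h2, h, true_and]
    · intro u _ hu
      rw [ite_eq_right_iff]
      intro _
      refine if_neg fun hI => hu ?_
      ext i
      rw [← hI]
      simp
    · intro hu
      rw [Fintype.mem_piFinset] at hu
      push Not at hu
      obtain ⟨i, hi⟩ := hu
      have hlt : K i < I i - K i := by
        simp only [mem_range] at hi
        omega
      rw [prod_eq_zero (mem_univ i) (Nat.choose_eq_zero_of_lt hlt)]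
      simp
  · rw [if_neg fun h' => h h'.1]
    refine sum_eq_zero fun u _ => ?_
    rw [ite_eq_right_iff]
    intro _
    refine if_neg fun hI => h ?_
    rw [← hI]
    exact le_self_add

/-- The heart of the proof: by `smallv_succ` the product is `sqHom` of a shorter one times a power
of x_1, and `sqHom` has the same binomial coefficients as the Steenrod squares. -/
theorem vCoeff_cons {k : ℕ} (t j : ℕ) (I : Fin k →₀ ℕ) (J : Fin k → ℕ)
    (hIJ : t + ∑ i, I i = j + ∑ i, J i) :
    vCoeff (Finsupp.cons t I) (Fin.cons j J) = if t ≤ j then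
      ∑ K ∈ Iic I, MvPolynomial.coeff I (Sq (j - t) (MvPolynomial.monomial K (1 : ZMod 2))) *
        vCoeff K J else 0 := by
  have hprod : ∏ m, (smallv m : Laurent (k + 1)) ^ (Fin.cons j J : Fin (k + 1) → ℕ) m =
      sqHom k (∏ m, smallv m ^ J m) *
        single (toLex (Pi.single 0 ((j : ℤ) - ∑ i, (J i : ℤ)))) 1 := by
    rw [Fin.prod_univ_succ]
    simp only [Fin.cons_zero, Fin.cons_succ, smallv_zero, smallv_succ, mul_pow, prod_mul_distrib,
      map_prod, map_pow]
    rw [prod_pow_eq_pow_sum, xvar_zero_inv, xvar, single_pow, single_pow, mul_left_comm,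
      single_mul_single]
    congr 2
    · congr 1
      apply ofLex.injective
      ext i
      change j • (Pi.single 0 (1 : ℤ) : Fin (k + 1) → ℤ) i +
        (∑ i, J i) • (Pi.single 0 (-1 : ℤ) : Fin (k + 1) → ℤ) i = _
      refine Fin.cases ?_ (fun l => ?_) i
      · simp [sub_eq_add_neg]
      · simp
    · simp
  have hexp : (toLex fun i => ((Finsupp.cons t I : Fin (k + 1) →₀ ℕ) i : ℤ)) -
      toLex (Pi.single 0 ((j : ℤ) - ∑ i, (J i : ℤ))) =
      toLex (Fin.cons ((t : ℤ) - (j - ∑ i, (J i : ℤ))) fun i => (I i : ℤ)) := by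
    apply ofLex.injective
    ext i
    change ((Finsupp.cons t I : Fin (k + 1) →₀ ℕ) i : ℤ) -
      (Pi.single 0 ((j : ℤ) - ∑ i, (J i : ℤ)) : Fin (k + 1) → ℤ) i = _
    refine Fin.cases ?_ (fun l => ?_) i <;> simp
  rw [vCoeff, hprod, coeff_mul_single, mul_one, hexp, coeff_sqHom_natCast]
  -- By homogeneity only |K| = |J| matters. Then `K ≤ I` and `hIJ` give `t ≤ j`, and both degree
  -- conditions hold.
  have hterm : ∀ K ∈ Iic I, (if 2 * ∑ i, (K i : ℤ) =
        ∑ i, (I i : ℤ) + ((t : ℤ) - (j - ∑ i, (J i : ℤ))) then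
      ((∏ i, (K i).choose (I i - K i) : ℕ) : ZMod 2) * vCoeff K J else 0) =
      if t ≤ j then MvPolynomial.coeff I (Sq (j - t) (MvPolynomial.monomial K (1 : ZMod 2))) *
        vCoeff K J else 0 := by
    intro K hK
    by_cases hKJ : ∑ i, K i = ∑ i, J i
    · have hle : ∑ i, K i ≤ ∑ i, I i := sum_le_sum fun i _ => mem_Iic.1 hK i
      have htj : t ≤ j := by omega
      have h1 : ∑ i, (K i : ℤ) = ∑ i, (J i : ℤ) := by exact_mod_cast hKJ
      have h2 : (t : ℤ) + ∑ i, (I i : ℤ) = j + ∑ i, (J i : ℤ) := by exact_mod_cast hIJ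
      have h3 : K ≤ I ∧ ∑ i, I i = ∑ i, K i + (j - t) := ⟨mem_Iic.1 hK, by omega⟩
      rw [coeff_Sq_monomial_eq, if_pos htj, if_pos h3, if_pos (by omega)]
    · rw [vCoeff_eq_zero hKJ]
      simp
  refine (sum_congr rfl hterm).trans ?_
  split_ifs <;> simp

end SingerTransfer

end

noncomputable section

namespace SingerTransfer

open Finset

/-! ### The recursion for the transfer -/

theorem coe_phi_single {k : ℕ} (I : Fin k →₀ ℕ) (c : ZMod 2) :
    (phi k (Finsupp.single I c) : Lambda) =
      c • ∑ J ∈ Nat.antidiagonalTuple k (∑ i, I i), vCoeff I J • lamMon J := by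
  have h : piAntidiag univ (∑ i, I i) = Nat.antidiagonalTuple k (∑ i, I i) := by
    ext J
    simp [Nat.mem_antidiagonalTuple, mem_piAntidiag]
  rw [phi, Finsupp.linearCombination_single, h]
  simp

theorem SqStar_single {k : ℕ} (s : ℕ) (I : Fin k →₀ ℕ) :
    SqStar s (Finsupp.single I 1) = ∑ K ∈ Iic I, Finsupp.single K
      (MvPolynomial.coeff I (Sq s (MvPolynomial.monomial K (1 : ZMod 2)))) := by
  rw [SqStar, Finsupp.linearCombination_single, one_smul]

theorem SqStar_single_eq_zero {k : ℕ} {s : ℕ} {I : Fin k →₀ ℕ} (h : ∑ i, I i < s) :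
    SqStar s (Finsupp.single I 1) = 0 := by
  rw [SqStar_single]
  refine sum_eq_zero fun K _ => ?_
  rw [coeff_Sq_monomial_eq, if_neg (by omega), Finsupp.single_zero]

theorem coe_phi_SqStar_single {k : ℕ} {s n : ℕ} {I : Fin k →₀ ℕ} (h : ∑ i, I i = n + s) :
    (phi k (SqStar s (Finsupp.single I 1)) : Lambda) = ∑ J ∈ Nat.antidiagonalTuple k n,
      (∑ K ∈ Iic I, MvPolynomial.coeff I (Sq s (MvPolynomial.monomial K (1 : ZMod 2))) *
        vCoeff K J) • lamMon J := by
  rw [SqStar_single, map_sum, Submodule.coe_sum]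
  simp_rw [coe_phi_single, sum_smul, mul_smul]
  rw [sum_comm]
  refine sum_congr rfl fun K _ => ?_
  rw [coeff_Sq_monomial_eq, smul_sum]
  split_ifs with hK
  · rw [show ∑ i, K i = n by omega]
  · simp

theorem lamMon_cons {k : ℕ} (j : ℕ) (J : Fin k → ℕ) :
    lamMon (Fin.cons j J : Fin (k + 1) → ℕ) = lam j * lamMon J := by
  rw [lamMon, lamMon, List.ofFn_succ, List.prod_cons]
  simp

theorem sum_antidiagonalTuple_succ {k : ℕ} {M : Type*} [AddCommMonoid M] (n : ℕ)
    (f : (Fin (k + 1) → ℕ) → M) :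
    ∑ J ∈ Nat.antidiagonalTuple (k + 1) n, f J =
      ∑ j ∈ range (n + 1), ∑ J ∈ Nat.antidiagonalTuple k (n - j), f (Fin.cons j J) := by
  rw [sum_sigma']
  refine sum_bij' (fun J _ => ⟨J 0, Fin.tail J⟩) (fun p _ => Fin.cons p.1 p.2) ?_ ?_ ?_ ?_ ?_
  · intro J hJ
    rw [Nat.mem_antidiagonalTuple, Fin.sum_univ_succ] at hJ
    simp only [mem_sigma, mem_range, Nat.mem_antidiagonalTuple, Fin.tail_def]
    omega
  · rintro ⟨j, J⟩ hJ
    simp only [mem_sigma, mem_range, Nat.mem_antidiagonalTuple] at hJ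
    rw [Nat.mem_antidiagonalTuple, Fin.sum_univ_succ]
    simp only [Fin.cons_zero, Fin.cons_succ]
    omega
  · intro J _
    exact Fin.cons_self_tail J
  · rintro ⟨j, J⟩ _
    simp
  · intro J _
    rw [Fin.cons_self_tail]

/-- The first index of `J` is split off and `vCoeff_cons` applied. The bound `N` is left free, as
the extra dual squares vanish, so that nested sums can later share one range. -/
theorem phi_succ_eq_sum_range {k : ℕ} (t : Fin (k + 1) → ℕ) {N : ℕ} (hN : ∑ i, t i < N) :
    (phi (k + 1) (aMon t) : Lambda) = ∑ i ∈ range N, if t 0 ≤ i then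
      lam i * (phi k (SqStar (i - t 0) (aMon (Fin.tail t))) : Lambda) else 0 := by
  set I : Fin k →₀ ℕ := Finsupp.equivFunOnFinite.symm (Fin.tail t) with hI
  have hIt : Finsupp.equivFunOnFinite.symm t = Finsupp.cons (t 0) I := by
    ext i
    refine Fin.cases ?_ (fun j => ?_) i <;> simp [hI, Fin.tail_def]
  have hsum : ∑ i, t i = t 0 + ∑ i, I i := by
    rw [Fin.sum_univ_succ]
    simp [hI, Fin.tail_def]
  have hsum' : ∑ i, (Finsupp.cons (t 0) I : Fin (k + 1) →₀ ℕ) i = ∑ i, t i := by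
    rw [← hIt]
    simp
  have ha : aMon (Fin.tail t) = Finsupp.single I 1 := rfl
  rw [aMon, hIt, coe_phi_single, one_smul, hsum', sum_antidiagonalTuple_succ, ha]
  have hsub : range (∑ i, t i + 1) ⊆ range N := range_subset_range.2 hN
  rw [← sum_subset hsub]
  · refine sum_congr rfl fun j hj => ?_
    rw [mem_range] at hj
    have hv : ∀ J ∈ Nat.antidiagonalTuple k (∑ i, t i - j),
        t 0 + ∑ i, I i = j + ∑ i, J i := fun J hJ => by
      rw [Nat.mem_antidiagonalTuple] at hJ
      omega
    split_ifs with htj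
    · rw [coe_phi_SqStar_single (n := ∑ i, t i - j) (by omega), mul_sum]
      refine sum_congr rfl fun J hJ => ?_
      rw [vCoeff_cons _ _ _ _ (hv J hJ), if_pos htj, lamMon_cons, mul_smul_comm]
    · refine sum_eq_zero fun J hJ => ?_
      rw [vCoeff_cons _ _ _ _ (hv J hJ), if_neg htj, zero_smul]
  · intro i _ hi
    rw [mem_range] at hi
    rw [SqStar_single_eq_zero (by omega)]
    simp

theorem finsum_prop_eq_sum_range {M : Type*} [AddCommMonoid M] {p : ℕ → Prop} [DecidablePred p]
    {F : ℕ → M} (N : ℕ) (h : ∀ i, N ≤ i → p i → F i = 0) :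
    ∑ᶠ (i : ℕ) (_ : p i), F i = ∑ i ∈ range N, if p i then F i else 0 := by
  simp_rw [finsum_eq_if]
  refine finsum_eq_sum_of_support_subset _ fun i hi => ?_
  rw [mem_coe, mem_range]
  by_contra hN
  apply hi
  by_cases hp : p i
  · exact (if_pos hp).trans (h i (by omega) hp)
  · exact if_neg hp

theorem SqStar_aMon_eq_zero {k : ℕ} {s : ℕ} {t : Fin k → ℕ} (h : ∑ i, t i < s) :
    SqStar s (aMon t) = 0 := SqStar_single_eq_zero (by simpa using h)

theorem finite_SqStar_ne_zero {k : ℕ} (t₀ : ℕ) (t : Fin k → ℕ) :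
    {i : ℕ | t₀ ≤ i ∧ SqStar (i - t₀) (aMon t) ≠ 0}.Finite := by
  refine (Set.finite_Iic (t₀ + ∑ i, t i)).subset fun i hi => ?_
  by_contra h
  rw [Set.mem_Iic] at h
  exact hi.2 (SqStar_aMon_eq_zero (by omega))

theorem phi_succ_eq_finsum {k : ℕ} (t : Fin (k + 1) → ℕ) :
    (phi (k + 1) (aMon t) : Lambda) = ∑ᶠ (i : ℕ) (_ : t 0 ≤ i),
      lam i * (phi k (SqStar (i - t 0) (aMon (Fin.tail t))) : Lambda) := by
  rw [phi_succ_eq_sum_range t (Nat.lt_succ_self _), finsum_prop_eq_sum_range]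
  intro i hi _
  rw [Fin.sum_univ_succ] at hi
  rw [SqStar_aMon_eq_zero (by simp only [Fin.tail_def]; omega)]
  simp

/-! ### Dual Steenrod operations on the monomial basis -/

theorem binom_natCast (n m : ℕ) : binom n m = (n.choose m : ZMod 2) := by
  rw [binom]
  split_ifs with h
  · simp
  · rw [Nat.choose_eq_zero_of_lt (by omega), Nat.cast_zero]

theorem binom_of_neg {n m : ℤ} (h : n < 0) : binom n m = 0 := if_neg (by omega)

/-- This is `coeff_Sq_monomial_eq` with `K = t - u`. If some `u i > t i`, the integer `t i - u i` is
negative and `binom` is zero, so truncated subtraction inside `aMon` is harmless. -/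
theorem SqStar_aMon {k : ℕ} (s : ℕ) (t : Fin k → ℕ) :
    SqStar s (aMon t) = ∑ u ∈ Nat.antidiagonalTuple k s,
      (∏ i, binom (t i - u i) (u i)) • aMon fun i => t i - u i := by
  set I : Fin k →₀ ℕ := Finsupp.equivFunOnFinite.symm t with hI
  have hIt : ∀ i, I i = t i := fun i => rfl
  rw [aMon, ← hI, SqStar_single]
  simp_rw [coeff_Sq_monomial_eq]
  have h1 : ∀ u ∈ Nat.antidiagonalTuple k s, (∏ i, binom (t i - u i) (u i)) •
      aMon (fun i => t i - u i) ≠ 0 → ∀ i, u i ≤ t i := by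
    intro u _ hne i
    by_contra hi
    refine hne ?_
    rw [prod_eq_zero (mem_univ i) (binom_of_neg (by omega)), zero_smul]
  have h2 : ∀ K ∈ Iic I, Finsupp.single K (if K ≤ I ∧ ∑ i, I i = ∑ i, K i + s then
      ((∏ i, (K i).choose (I i - K i) : ℕ) : ZMod 2) else 0) ≠ 0 →
      ∑ i, I i = ∑ i, K i + s := by
    intro K _ hne
    by_contra h
    exact hne (by rw [if_neg fun h' => h h'.2, Finsupp.single_zero])
  rw [← sum_filter_of_ne h1, ← sum_filter_of_ne h2]
  refine sum_bij' (fun K _ i => t i - K i)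
    (fun u _ => Finsupp.equivFunOnFinite.symm fun i => t i - u i) ?_ ?_ ?_ ?_ ?_
  · intro K hK
    rw [mem_filter, mem_Iic] at hK
    rw [mem_filter, Nat.mem_antidiagonalTuple]
    refine ⟨?_, fun i => Nat.sub_le _ _⟩
    have : ∑ i, I i = ∑ i, K i + ∑ i, (t i - K i) := by
      rw [← sum_add_distrib]
      exact sum_congr rfl fun i _ => (Nat.add_sub_cancel' (hK.1 i)).symm
    omega
  · intro u hu
    rw [mem_filter, Nat.mem_antidiagonalTuple] at hu
    rw [mem_filter, mem_Iic]
    refine ⟨fun i => Nat.sub_le _ _, ?_⟩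
    rw [← hu.1, ← sum_add_distrib]
    exact sum_congr rfl fun i _ => (Nat.sub_add_cancel (hu.2 i)).symm
  · intro K hK
    rw [mem_filter, mem_Iic] at hK
    ext i
    exact Nat.sub_sub_self (hK.1 i)
  · intro u hu
    rw [mem_filter] at hu
    ext i
    exact Nat.sub_sub_self (hu.2 i)
  · intro K hK
    rw [mem_filter, mem_Iic] at hK
    have hle : ∀ i, K i ≤ t i := fun i => hK.1 i
    have hb : ∀ i, binom (t i - ((t i - K i : ℕ) : ℤ)) ((t i - K i : ℕ) : ℤ) =
        ((K i).choose (I i - K i) : ZMod 2) := fun i => by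
      rw [← hIt, ← binom_natCast]
      congr 1
      have := hK.1 i
      omega
    simp_rw [hb]
    rw [if_pos hK, aMon, Finsupp.smul_single, smul_eq_mul, mul_one]
    push_cast
    congr 1
    ext i
    exact (Nat.sub_sub_self (hK.1 i)).symm

/-- Needed because the explicit formulas number the summation variables backwards: `u 0` belongs to
the last exponent. -/
theorem sum_antidiagonalTuple_rev {k : ℕ} {M : Type*} [AddCommMonoid M] (s : ℕ)
    (f : (Fin k → ℕ) → M) :
    ∑ u ∈ Nat.antidiagonalTuple k s, f u =
      ∑ u ∈ Nat.antidiagonalTuple k s, f fun i : Fin k => u i.rev := by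
  have h : ∀ u : Fin k → ℕ, ∑ i : Fin k, u i.rev = ∑ i, u i := fun u =>
    Equiv.sum_comp Fin.revPerm u
  refine sum_bij' (fun u _ => fun i : Fin k => u i.rev) (fun u _ => fun i : Fin k => u i.rev)
    ?_ ?_ ?_ ?_ ?_
  · intro u hu
    rwa [Nat.mem_antidiagonalTuple, h, ← Nat.mem_antidiagonalTuple]
  · intro u hu
    rwa [Nat.mem_antidiagonalTuple, h, ← Nat.mem_antidiagonalTuple]
  all_goals simp

/-- The recursion for the transfer, with the dual Steenrod operations written out on monomials. -/
theorem phi_succ_eq_sum_binom {k : ℕ} (t₀ : ℕ) (t : Fin k → ℕ) {N : ℕ} (hN : t₀ + ∑ i, t i < N) :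
    (phi (k + 1) (aMon (Fin.cons t₀ t)) : Lambda) = ∑ i ∈ range N, if t₀ ≤ i then
      ∑ u ∈ Nat.antidiagonalTuple k (i - t₀), (∏ j, binom (t j - u j.rev) (u j.rev)) •
        (lam i * (phi k (aMon fun j => t j - u j.rev) : Lambda)) else 0 := by
  rw [phi_succ_eq_sum_range _ (N := N) (by simpa [Fin.sum_univ_succ] using hN)]
  refine sum_congr rfl fun i _ => ?_
  simp only [Fin.cons_zero, Fin.tail_cons]
  rw [SqStar_aMon, sum_antidiagonalTuple_rev]
  simp [mul_sum]

/-! ### Explicit formulas up to rank five -/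

theorem lamZ_natCast (n : ℕ) : lamZ n = lam n := by simp [lamZ]

theorem lamZ_of_neg {n : ℤ} (h : n < 0) : lamZ n = 0 := if_neg (by omega)

theorem phi_zero_aMon (t : Fin 0 → ℕ) : (phi 0 (aMon t) : Lambda) = 1 := by
  rw [aMon, coe_phi_single]
  simp [vCoeff, lamMon, HahnSeries.coeff_one]
  exact fun h => absurd (Subsingleton.elim _ _) h

theorem phi_one_aMon (t : ℕ) : (phi 1 (aMon ![t]) : Lambda) = lam t := by
  refine (phi_succ_eq_sum_binom t ![] (N := t + 1) (by simp)).trans ?_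
  rw [sum_eq_single_of_mem t (by simp)]
  · simp [phi_zero_aMon]
  · intro i hi hne
    rw [ite_eq_right_iff]
    intro hti
    -- The empty tuple has sum 0, so only `i = t` contributes.
    obtain ⟨m, hm⟩ : ∃ m, i - t = m + 1 := ⟨i - t - 1, by omega⟩
    rw [hm, Nat.antidiagonalTuple_zero_succ, sum_empty]

theorem phi_two_aMon (t₁ t₂ : ℕ) {N : ℕ} (hN : t₁ + t₂ < N) :
    (phi 2 (aMon ![t₁, t₂]) : Lambda) = ∑ i ∈ range N, if t₁ ≤ i then
      binom (t₁ + t₂ - i) (i - t₁) • (lam i * lamZ (t₁ + t₂ - i)) else 0 := by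
  refine (phi_succ_eq_sum_binom t₁ ![t₂] (N := N) (by simpa using hN)).trans ?_
  refine sum_congr rfl fun i _ => if_ctx_congr Iff.rfl (fun hi => ?_) fun _ => rfl
  rw [Nat.antidiagonalTuple_one, sum_singleton, Fin.prod_univ_one]
  obtain ⟨v, rfl⟩ := Nat.exists_eq_add_of_le hi
  by_cases hv : v ≤ t₂
  · obtain ⟨s, rfl⟩ := Nat.exists_eq_add_of_le hv
    have ht : (fun j => ![v + s] j - ![t₁ + v - t₁] j.rev) = ![s] := by
      ext j
      fin_cases j
      simp
    rw [ht, phi_one_aMon]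
    simp only [Nat.add_sub_cancel_left, Matrix.cons_val_fin_one]
    congr 2
    · push_cast; ring
    · push_cast; ring
    · rw [← lamZ_natCast]
      congr 1
      push_cast
      ring
  -- For `v > t₂` both sides are zero: the upper entry of `binom` and the last subscript of λ are
  -- negative.
  · rw [binom_of_neg, lamZ_of_neg]
    · simp
    · omega
    · simp
      omega

theorem phi_three_aMon (t₁ t₂ t₃ : ℕ) {N : ℕ} (hN : t₁ + t₂ + t₃ < N) :
    (phi 3 (aMon ![t₁, t₂, t₃]) : Lambda) = ∑ i₁ ∈ range N, if t₁ ≤ i₁ then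
      ∑ u ∈ Nat.antidiagonalTuple 2 (i₁ - t₁), ∑ i₂ ∈ range N, if t₂ ≤ i₂ + u 1 then
        (binom (t₃ - u 0) (u 0) * binom (t₂ - u 1) (u 1) *
          binom (t₁ + t₂ + t₃ - i₁ - i₂) (i₂ + u 1 - t₂)) •
        (lam i₁ * lam i₂ * lamZ (t₁ + t₂ + t₃ - i₁ - i₂)) else 0 else 0 := by
  refine (phi_succ_eq_sum_binom t₁ ![t₂, t₃] (N := N)
    (by simpa [Fin.sum_univ_two, add_assoc] using hN)).trans ?_
  refine sum_congr rfl fun i₁ _ => if_ctx_congr Iff.rfl (fun hi => ?_) fun _ => rfl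
  refine sum_congr rfl fun u hu => ?_
  rw [Nat.mem_antidiagonalTuple, Fin.sum_univ_two] at hu
  have hc : ∏ j, binom ((![t₂, t₃] j : ℕ) - u j.rev) (u j.rev) =
      binom (t₃ - u 0) (u 0) * binom (t₂ - u 1) (u 1) := by
    rw [Fin.prod_univ_two, mul_comm]
    rfl
  have hu' : (fun j => ![t₂, t₃] j - u j.rev) = ![t₂ - u 1, t₃ - u 0] := by
    ext j
    fin_cases j <;> rfl
  rw [hc, hu']
  -- In this case the natural subtractions are exact and the formula of rank two applies; otherwise
  -- the prefactor already vanishes. Ranks four and five use the same dichotomy.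
  by_cases hle : u 1 ≤ t₂ ∧ u 0 ≤ t₃
  · obtain ⟨h1, h0⟩ := hle
    rw [phi_two_aMon _ _ (N := N) (by omega), mul_sum, smul_sum]
    refine sum_congr rfl fun i₂ _ => ?_
    rw [mul_ite, mul_zero, smul_ite, smul_zero]
    refine if_ctx_congr (by omega) (fun _ => ?_) fun _ => rfl
    rw [mul_smul_comm, smul_smul, mul_assoc (lam i₁)]
    push_cast [h0, h1]
    have e1 : (t₂ : ℤ) - u 1 + (t₃ - u 0) - i₂ = t₁ + t₂ + t₃ - i₁ - i₂ := by omega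
    have e2 : (i₂ : ℤ) - (t₂ - u 1) = i₂ + u 1 - t₂ := by omega
    rw [e1, e2]
  · have h0 : binom (t₃ - u 0) (u 0) * binom (t₂ - u 1) (u 1) = 0 := by
      rw [mul_eq_zero]
      by_contra! H
      exact hle ⟨by_contra fun h => H.2 (binom_of_neg (by omega)),
        by_contra fun h => H.1 (binom_of_neg (by omega))⟩
    simp [h0]

theorem phi_four_aMon (t₁ t₂ t₃ t₄ : ℕ) {N : ℕ} (hN : t₁ + t₂ + t₃ + t₄ < N) :
    (phi 4 (aMon ![t₁, t₂, t₃, t₄]) : Lambda) = ∑ i₁ ∈ range N, if t₁ ≤ i₁ then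
      ∑ κ ∈ Nat.antidiagonalTuple 3 (i₁ - t₁), ∑ i₂ ∈ range N, if t₂ ≤ i₂ + κ 2 then
      ∑ u ∈ Nat.antidiagonalTuple 2 (i₂ + κ 2 - t₂),
      ∑ i₃ ∈ range N, if t₃ ≤ i₃ + κ 1 + u 1 then
        (binom (t₄ - κ 0) (κ 0) * binom (t₃ - κ 1) (κ 1) * binom (t₂ - κ 2) (κ 2) *
          binom (t₄ - κ 0 - u 0) (u 0) * binom (t₃ - κ 1 - u 1) (u 1) *
          binom (t₁ + t₂ + t₃ + t₄ - i₁ - i₂ - i₃) (i₃ + κ 1 + u 1 - t₃)) •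
        (lam i₁ * lam i₂ * lam i₃ * lamZ (t₁ + t₂ + t₃ + t₄ - i₁ - i₂ - i₃))
        else 0 else 0 else 0 := by
  refine (phi_succ_eq_sum_binom t₁ ![t₂, t₃, t₄] (N := N)
    (by simpa [Fin.sum_univ_three, add_assoc] using hN)).trans ?_
  refine sum_congr rfl fun i₁ _ => if_ctx_congr Iff.rfl (fun hi => ?_) fun _ => rfl
  refine sum_congr rfl fun κ hκ => ?_
  rw [Nat.mem_antidiagonalTuple, Fin.sum_univ_three] at hκ
  have hc : ∏ j, binom ((![t₂, t₃, t₄] j : ℕ) - κ j.rev) (κ j.rev) =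
      binom (t₄ - κ 0) (κ 0) * binom (t₃ - κ 1) (κ 1) * binom (t₂ - κ 2) (κ 2) := by
    have h : ∀ a b c : ZMod 2, a * b * c = c * b * a := fun a b c => by ring
    rw [Fin.prod_univ_three, h]
    rfl
  have hκ' : (fun j => ![t₂, t₃, t₄] j - κ j.rev) = ![t₂ - κ 2, t₃ - κ 1, t₄ - κ 0] := by
    ext j
    fin_cases j <;> rfl
  rw [hc, hκ']
  by_cases hle : κ 2 ≤ t₂ ∧ κ 1 ≤ t₃ ∧ κ 0 ≤ t₄
  · obtain ⟨h2, h1, h0⟩ := hle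
    rw [phi_three_aMon _ _ _ (N := N) (by omega), mul_sum, smul_sum]
    refine sum_congr rfl fun i₂ _ => ?_
    rw [mul_ite, mul_zero, smul_ite, smul_zero]
    refine if_ctx_congr (by omega) (fun _ => ?_) fun _ => rfl
    rw [mul_sum, smul_sum, show i₂ - (t₂ - κ 2) = i₂ + κ 2 - t₂ by omega]
    refine sum_congr rfl fun u _ => ?_
    rw [mul_sum, smul_sum]
    refine sum_congr rfl fun i₃ _ => ?_
    rw [mul_ite, mul_zero, smul_ite, smul_zero]
    refine if_ctx_congr (by omega) (fun _ => ?_) fun _ => rfl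
    rw [mul_smul_comm, smul_smul]
    simp only [mul_assoc]
    push_cast [h0, h1, h2]
    have e1 : (t₂ : ℤ) - κ 2 + (t₃ - κ 1) + (t₄ - κ 0) - i₂ - i₃ =
      t₁ + t₂ + t₃ + t₄ - i₁ - i₂ - i₃ := by omega
    have e2 : (i₃ : ℤ) + u 1 - (t₃ - κ 1) = i₃ + κ 1 + u 1 - t₃ := by omega
    rw [e1, e2]
  · have h0 : binom (t₄ - κ 0) (κ 0) * binom (t₃ - κ 1) (κ 1) * binom (t₂ - κ 2) (κ 2) = 0 := by
      rw [mul_eq_zero, mul_eq_zero]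
      by_contra! H
      exact hle ⟨by_contra fun h => H.2 (binom_of_neg (by omega)),
        by_contra fun h => H.1.2 (binom_of_neg (by omega)),
        by_contra fun h => H.1.1 (binom_of_neg (by omega))⟩
    simp [h0]

theorem phi_five_aMon (t₁ t₂ t₃ t₄ t₅ : ℕ) {N : ℕ} (hN : t₁ + t₂ + t₃ + t₄ + t₅ < N) :
    (phi 5 (aMon ![t₁, t₂, t₃, t₄, t₅]) : Lambda) = ∑ i₁ ∈ range N, if t₁ ≤ i₁ then
      ∑ w ∈ Nat.antidiagonalTuple 4 (i₁ - t₁), ∑ i₂ ∈ range N, if t₂ ≤ i₂ + w 3 then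
      ∑ κ ∈ Nat.antidiagonalTuple 3 (i₂ + w 3 - t₂),
      ∑ i₃ ∈ range N, if t₃ ≤ i₃ + κ 2 + w 2 then
      ∑ u ∈ Nat.antidiagonalTuple 2 (i₃ + κ 2 + w 2 - t₃),
      ∑ i₄ ∈ range N, if t₄ ≤ i₄ + κ 1 + u 1 + w 1 then
        (binom (t₅ - w 0) (w 0) * binom (t₄ - w 1) (w 1) * binom (t₃ - w 2) (w 2) *
          binom (t₂ - w 3) (w 3) *
          binom (t₅ - κ 0 - w 0) (κ 0) * binom (t₄ - κ 1 - w 1) (κ 1) *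
          binom (t₃ - κ 2 - w 2) (κ 2) *
          binom (t₅ - κ 0 - u 0 - w 0) (u 0) * binom (t₄ - κ 1 - u 1 - w 1) (u 1) *
          binom (t₁ + t₂ + t₃ + t₄ + t₅ - i₁ - i₂ - i₃ - i₄)
            (i₄ + κ 1 + u 1 + w 1 - t₄)) •
        (lam i₁ * lam i₂ * lam i₃ * lam i₄ *
          lamZ (t₁ + t₂ + t₃ + t₄ + t₅ - i₁ - i₂ - i₃ - i₄))
        else 0 else 0 else 0 else 0 := by
  refine (phi_succ_eq_sum_binom t₁ ![t₂, t₃, t₄, t₅] (N := N)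
    (by simpa [Fin.sum_univ_four, add_assoc] using hN)).trans ?_
  refine sum_congr rfl fun i₁ _ => if_ctx_congr Iff.rfl (fun hi => ?_) fun _ => rfl
  refine sum_congr rfl fun w hw => ?_
  rw [Nat.mem_antidiagonalTuple, Fin.sum_univ_four] at hw
  have hc : ∏ j, binom ((![t₂, t₃, t₄, t₅] j : ℕ) - w j.rev) (w j.rev) =
      binom (t₅ - w 0) (w 0) * binom (t₄ - w 1) (w 1) * binom (t₃ - w 2) (w 2) *
        binom (t₂ - w 3) (w 3) := by
    have h : ∀ a b c d : ZMod 2, a * b * c * d = d * c * b * a := fun a b c d => by ring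
    rw [Fin.prod_univ_four, h]
    rfl
  have hw' : (fun j => ![t₂, t₃, t₄, t₅] j - w j.rev) =
      ![t₂ - w 3, t₃ - w 2, t₄ - w 1, t₅ - w 0] := by
    ext j
    fin_cases j <;> rfl
  rw [hc, hw']
  by_cases hle : w 3 ≤ t₂ ∧ w 2 ≤ t₃ ∧ w 1 ≤ t₄ ∧ w 0 ≤ t₅
  · obtain ⟨h3, h2, h1, h0⟩ := hle
    rw [phi_four_aMon _ _ _ _ (N := N) (by omega), mul_sum, smul_sum]
    refine sum_congr rfl fun i₂ _ => ?_
    rw [mul_ite, mul_zero, smul_ite, smul_zero]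
    refine if_ctx_congr (by omega) (fun _ => ?_) fun _ => rfl
    rw [mul_sum, smul_sum, show i₂ - (t₂ - w 3) = i₂ + w 3 - t₂ by omega]
    refine sum_congr rfl fun κ _ => ?_
    rw [mul_sum, smul_sum]
    refine sum_congr rfl fun i₃ _ => ?_
    rw [mul_ite, mul_zero, smul_ite, smul_zero]
    refine if_ctx_congr (by omega) (fun _ => ?_) fun _ => rfl
    rw [mul_sum, smul_sum, show i₃ + κ 2 - (t₃ - w 2) = i₃ + κ 2 + w 2 - t₃ by omega]
    refine sum_congr rfl fun u _ => ?_
    rw [mul_sum, smul_sum]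
    refine sum_congr rfl fun i₄ _ => ?_
    rw [mul_ite, mul_zero, smul_ite, smul_zero]
    refine if_ctx_congr (by omega) (fun _ => ?_) fun _ => rfl
    rw [mul_smul_comm, smul_smul]
    simp only [mul_assoc]
    push_cast [h0, h1, h2, h3]
    have e1 : (t₂ : ℤ) - w 3 + (t₃ - w 2) + (t₄ - w 1) + (t₅ - w 0) - i₂ - i₃ - i₄ =
      t₁ + t₂ + t₃ + t₄ + t₅ - i₁ - i₂ - i₃ - i₄ := by omega
    have e2 : (i₄ : ℤ) + κ 1 + u 1 - (t₄ - w 1) = i₄ + κ 1 + u 1 + w 1 - t₄ := by omega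
    have e3 : (t₅ : ℤ) - w 0 - κ 0 - u 0 = t₅ - κ 0 - u 0 - w 0 := by omega
    have e4 : (t₄ : ℤ) - w 1 - κ 1 - u 1 = t₄ - κ 1 - u 1 - w 1 := by omega
    rw [e1, e2, e3, e4, sub_right_comm (t₅ : ℤ) (w 0), sub_right_comm (t₄ : ℤ) (w 1),
      sub_right_comm (t₃ : ℤ) (w 2)]
  · have h0 : binom (t₅ - w 0) (w 0) * binom (t₄ - w 1) (w 1) * binom (t₃ - w 2) (w 2) *
        binom (t₂ - w 3) (w 3) = 0 := by
      rw [mul_eq_zero, mul_eq_zero, mul_eq_zero]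
      by_contra! H
      exact hle ⟨by_contra fun h => H.2 (binom_of_neg (by omega)),
        by_contra fun h => H.1.2 (binom_of_neg (by omega)),
        by_contra fun h => H.1.1.2 (binom_of_neg (by omega)),
        by_contra fun h => H.1.1.1 (binom_of_neg (by omega))⟩
    simp [h0]

end SingerTransfer

end

/-! ### From bounded sums to the stated sums -/

open SingerTransfer in
theorem mainTheorem7 :
    (∀ (k : ℕ) (t : Fin (k + 1) → ℕ),
      {i : ℕ | t 0 ≤ i ∧ SqStar (i - t 0) (aMon (Fin.tail t)) ≠ 0}.Finite ∧
      (phi (k + 1) (aMon t) : Lambda) =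
        ∑ᶠ (i : ℕ) (_ : t 0 ≤ i),
          lam i * (phi k (SqStar (i - t 0) (aMon (Fin.tail t))) : Lambda)) ∧
    (∀ t₁ t₂ t₃ : ℕ,
      (phi 3 (aMon ![t₁, t₂, t₃]) : Lambda) =
        ∑ᶠ (i₁ : ℕ) (_ : t₁ ≤ i₁),
        ∑ u ∈ Finset.Nat.antidiagonalTuple 2 (i₁ - t₁),
        ∑ᶠ (i₂ : ℕ) (_ : t₂ ≤ i₂ + u 1),
          (binom (t₃ - u 0) (u 0) * binom (t₂ - u 1) (u 1) *
            binom (t₁ + t₂ + t₃ - i₁ - i₂) (i₂ + u 1 - t₂)) •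
          (lam i₁ * lam i₂ * lamZ (t₁ + t₂ + t₃ - i₁ - i₂))) ∧
    (∀ t₁ t₂ t₃ t₄ : ℕ,
      (phi 4 (aMon ![t₁, t₂, t₃, t₄]) : Lambda) =
        ∑ᶠ (i₁ : ℕ) (_ : t₁ ≤ i₁),
        ∑ κ ∈ Finset.Nat.antidiagonalTuple 3 (i₁ - t₁),
        ∑ᶠ (i₂ : ℕ) (_ : t₂ ≤ i₂ + κ 2),
        ∑ u ∈ Finset.Nat.antidiagonalTuple 2 (i₂ + κ 2 - t₂),
        ∑ᶠ (i₃ : ℕ) (_ : t₃ ≤ i₃ + κ 1 + u 1),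
          (binom (t₄ - κ 0) (κ 0) * binom (t₃ - κ 1) (κ 1) * binom (t₂ - κ 2) (κ 2) *
            binom (t₄ - κ 0 - u 0) (u 0) * binom (t₃ - κ 1 - u 1) (u 1) *
            binom (t₁ + t₂ + t₃ + t₄ - i₁ - i₂ - i₃) (i₃ + κ 1 + u 1 - t₃)) •
          (lam i₁ * lam i₂ * lam i₃ * lamZ (t₁ + t₂ + t₃ + t₄ - i₁ - i₂ - i₃))) ∧
    (∀ t₁ t₂ t₃ t₄ t₅ : ℕ,
      (phi 5 (aMon ![t₁, t₂, t₃, t₄, t₅]) : Lambda) =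
        ∑ᶠ (i₁ : ℕ) (_ : t₁ ≤ i₁),
        ∑ w ∈ Finset.Nat.antidiagonalTuple 4 (i₁ - t₁),
        ∑ᶠ (i₂ : ℕ) (_ : t₂ ≤ i₂ + w 3),
        ∑ κ ∈ Finset.Nat.antidiagonalTuple 3 (i₂ + w 3 - t₂),
        ∑ᶠ (i₃ : ℕ) (_ : t₃ ≤ i₃ + κ 2 + w 2),
        ∑ u ∈ Finset.Nat.antidiagonalTuple 2 (i₃ + κ 2 + w 2 - t₃),
        ∑ᶠ (i₄ : ℕ) (_ : t₄ ≤ i₄ + κ 1 + u 1 + w 1),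
          (binom (t₅ - w 0) (w 0) * binom (t₄ - w 1) (w 1) * binom (t₃ - w 2) (w 2) *
            binom (t₂ - w 3) (w 3) *
            binom (t₅ - κ 0 - w 0) (κ 0) * binom (t₄ - κ 1 - w 1) (κ 1) *
            binom (t₃ - κ 2 - w 2) (κ 2) *
            binom (t₅ - κ 0 - u 0 - w 0) (u 0) * binom (t₄ - κ 1 - u 1 - w 1) (u 1) *
            binom (t₁ + t₂ + t₃ + t₄ + t₅ - i₁ - i₂ - i₃ - i₄)
              (i₄ + κ 1 + u 1 + w 1 - t₄)) •
          (lam i₁ * lam i₂ * lam i₃ * lam i₄ *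
            lamZ (t₁ + t₂ + t₃ + t₄ + t₅ - i₁ - i₂ - i₃ - i₄))) := by
  refine ⟨fun k t => ⟨finite_SqStar_ne_zero _ _, phi_succ_eq_finsum t⟩, fun t₁ t₂ t₃ => ?_,
    fun t₁ t₂ t₃ t₄ => ?_, fun t₁ t₂ t₃ t₄ t₅ => ?_⟩
  -- Once any of the outer indices reaches `N`, one more than the total degree, the last λ has a
  -- negative subscript and the term is zero. Every `finsum` therefore reduces to `range N`.
  · set N := t₁ + t₂ + t₃ + 1 with hN
    rw [phi_three_aMon t₁ t₂ t₃ (N := N) (by omega), finsum_prop_eq_sum_range N]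
    · refine Finset.sum_congr rfl fun i₁ _ => if_ctx_congr Iff.rfl (fun _ => ?_) fun _ => rfl
      refine Finset.sum_congr rfl fun u _ => ?_
      rw [finsum_prop_eq_sum_range N]
      intro i hi _
      rw [lamZ_of_neg (by omega), mul_zero, smul_zero]
    · intro i hi _
      have h : ∀ i₂ : ℕ, lamZ (t₁ + t₂ + t₃ - i - i₂) = 0 := fun _ => lamZ_of_neg (by omega)
      simp only [h, mul_zero, smul_zero, finsum_zero, Finset.sum_const_zero]
  · set N := t₁ + t₂ + t₃ + t₄ + 1 with hN
    rw [phi_four_aMon t₁ t₂ t₃ t₄ (N := N) (by omega), finsum_prop_eq_sum_range N]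
    · refine Finset.sum_congr rfl fun i₁ _ => if_ctx_congr Iff.rfl (fun _ => ?_) fun _ => rfl
      refine Finset.sum_congr rfl fun κ _ => ?_
      rw [finsum_prop_eq_sum_range N]
      · refine Finset.sum_congr rfl fun i₂ _ => if_ctx_congr Iff.rfl (fun _ => ?_) fun _ => rfl
        refine Finset.sum_congr rfl fun u _ => ?_
        rw [finsum_prop_eq_sum_range N]
        intro i hi _
        rw [lamZ_of_neg (by omega), mul_zero, smul_zero]
      · intro i hi _
        have h : ∀ i₃ : ℕ, lamZ (t₁ + t₂ + t₃ + t₄ - i₁ - i - i₃) = 0 :=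
          fun _ => lamZ_of_neg (by omega)
        simp only [h, mul_zero, smul_zero, finsum_zero, Finset.sum_const_zero]
    · intro i hi _
      have h : ∀ i₂ i₃ : ℕ, lamZ (t₁ + t₂ + t₃ + t₄ - i - i₂ - i₃) = 0 :=
        fun _ _ => lamZ_of_neg (by omega)
      simp only [h, mul_zero, smul_zero, finsum_zero, Finset.sum_const_zero]
  · set N := t₁ + t₂ + t₃ + t₄ + t₅ + 1 with hN
    rw [phi_five_aMon t₁ t₂ t₃ t₄ t₅ (N := N) (by omega), finsum_prop_eq_sum_range N]
    · refine Finset.sum_congr rfl fun i₁ _ => if_ctx_congr Iff.rfl (fun _ => ?_) fun _ => rfl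
      refine Finset.sum_congr rfl fun w _ => ?_
      rw [finsum_prop_eq_sum_range N]
      · refine Finset.sum_congr rfl fun i₂ _ => if_ctx_congr Iff.rfl (fun _ => ?_) fun _ => rfl
        refine Finset.sum_congr rfl fun κ _ => ?_
        rw [finsum_prop_eq_sum_range N]
        · refine Finset.sum_congr rfl fun i₃ _ => if_ctx_congr Iff.rfl (fun _ => ?_) fun _ => rfl
          refine Finset.sum_congr rfl fun u _ => ?_
          rw [finsum_prop_eq_sum_range N]
          intro i hi _
          rw [lamZ_of_neg (by omega), mul_zero, smul_zero]
        · intro i hi _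
          have h : ∀ i₄ : ℕ, lamZ (t₁ + t₂ + t₃ + t₄ + t₅ - i₁ - i₂ - i - i₄) = 0 :=
            fun _ => lamZ_of_neg (by omega)
          simp only [h, mul_zero, smul_zero, finsum_zero, Finset.sum_const_zero]
      · intro i hi _
        have h : ∀ i₃ i₄ : ℕ, lamZ (t₁ + t₂ + t₃ + t₄ + t₅ - i₁ - i - i₃ - i₄) = 0 :=
          fun _ _ => lamZ_of_neg (by omega)
        simp only [h, mul_zero, smul_zero, finsum_zero, Finset.sum_const_zero]
    · intro i hi _
      have h : ∀ i₂ i₃ i₄ : ℕ, lamZ (t₁ + t₂ + t₃ + t₄ + t₅ - i - i₂ - i₃ - i₄) = 0 :=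
        fun _ _ _ => lamZ_of_neg (by omega)
      simp only [h, mul_zero, smul_zero, finsum_zero, Finset.sum_const_zero]
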